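/- Let $d\in\mathbb N$, let $\Omega=\{1,\dots,d\}^{\mathbb N}$ with the product topology and Borel $\sigma$-algebra, and let $\sigma(b_0,b_1,b_2,\dots)=(b_1,b_2,\dots)$ be the shift. A function $A:\Omega\to\mathbb R$ is called Hölder if there are $C$ and $\theta\in(0,1)$ with $|A(x)-A(y)|\le C\theta^n$ whenever $x$ and $y$ agree in their first $n$ coordinates. For a Hölder function $A$ the pressure is $$P(A)=\sup\Big\{\int A\,d\mu+h(\mu)\ :\ \mu \text{ a shift-invariant Borel probability measure on }\Omega\Big\},$$ where $h(\mu)$ is the Shannon–Kolmogorov entropy of $\mu$ (the supremum over finite measurable partitions $\xi$ of $\lim_n \frac1n H_\mu(\xi\vee\sigma^{-1}\xi\vee\dots\vee\sigma^{-(n-1)}\xi)$). A shift-invariant probability measure that attains this supremum is an equilibrium probability for $A$. For $j=0,1$ let $J_j:\Omega\to(0,\infty)$ be such that $\log J_j$ is Hölder and $\sum_{a=1}^d J_j(a,b_0,b_1,\dots)=1$ for all $(b_0,b_1,\dots)\in\Omega$, and let $\mu_j$ be the equilibrium probability for $\log J_j$. Put $$S_n(x)=\frac1n\sum_{i=0}^{n-1}\log\frac{J_0(\sigma^i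 x)}{J_1(\sigma^i x)},\qquad P_j(t)=P\big(t(\log J_0-\log J_1)+\log J_j\big)\quad(t\in\mathbb R),$$ $$c^-=\inf_{t\in\mathbb R}P_1'(t),\qquad c^+=\sup_{t\in\mathbb R}P_1'(t).$$ Let $(u_n)$ be a real sequence with $u_n\to E\in\mathbb R$, and let $I_j(x)=\sup_{t\in\mathbb R}\,[\,t(x+E)-P_j(t)\,]\in(-\infty,\infty]$ be the deviation functions. Then the following hold. **Proposition 3.1.** (i) If $E<\int(\log J_0-\log J_1)\,d\mu_1$, then $\lim_{n\to\infty}\mu_1(S_n-u_n>0)=1$. (ii) If $E>\int(\log J_0-\log J_1)\,d\mu_0$, then $\lim_{n\to\infty}\mu_0(S_n-u_n\le 0)=1$. (iii) If $E>\int(\log J_0-\log J_1)\,d\mu_1$, then $I_1(0)>0$, and if moreover $E\ne c^+$, then $$\lim_{n\to\infty}\frac1n\log\mu_1(S_n-u_n>0)=-I_1(0).$$ (iv) If $E<\int(\log J_0-\log J_1)\,d\mu_0$, then $I_0(0)>0$, and if moreover $E\ne c^-$, then $$\lim_{n\to\infty}\frac1n\log\mu_0(S_n-u_n\le 0)=-I_0(0).$$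 Here $\log 0=-\infty$, and both sides of the limits in (iii) and (iv) may be $-\infty$. -/

import Mathlib

open MeasureTheory Filter Topology

noncomputable section

namespace HolderGibbs

/-- The symbolic space `{1, …, d}^ℕ`, with the product topology and the product (that is, Borel)
`σ`-algebra. -/
abbrev Omega (d : ℕ) : Type := ℕ → Fin d

/-- The shift `σ(b₀, b₁, b₂, …) = (b₁, b₂, b₃, …)`. -/
def shift {d : ℕ} (x : Omega d) : Omega d := fun n => x (n + 1)

/-- The sequence `(a, b₀, b₁, …)` obtained by putting `a` in front of `(b₀, b₁, …)`. -/
def prepend {d : ℕ} (a : Fin d) (x : Omega d) : Omega d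
  | 0 => a
  | n + 1 => x n

/-- Hölder continuity on the symbolic space: the oscillation on cylinders of length `n` is at most
`C θⁿ` for some `θ ∈ (0, 1)`. Equivalently, `A` is Hölder for the metrics `ρ ^ N(x, y)`,
`0 < ρ < 1`, where `N(x, y)` is the first index at which `x` and `y` differ. -/
def IsHolder {d : ℕ} (A : Omega d → ℝ) : Prop :=
  ∃ C θ : ℝ, 0 < θ ∧ θ < 1 ∧
    ∀ (n : ℕ) (x y : Omega d), (∀ i < n, x i = y i) → |A x - A y| ≤ C * θ ^ n

/-- `μ` is a shift-invariant probability measure. -/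
def IsInvariantProb {d : ℕ} (μ : Measure (Omega d)) : Prop :=
  IsProbabilityMeasure μ ∧ MeasurePreserving shift μ μ

/-- A measurable map `f : Ω → Fin k` encodes a finite measurable partition `ξ`. This is the Shannon
entropy of the join `ξ ∨ σ⁻¹ ξ ∨ ⋯ ∨ σ⁻⁽ⁿ⁻¹⁾ ξ`, where `Real.negMulLog p = - p log p`. -/
def joinEntropy {d k : ℕ} (μ : Measure (Omega d)) (f : Omega d → Fin k) (n : ℕ) : ℝ :=
  ∑ w : Fin n → Fin k, Real.negMulLog (μ.real {x | ∀ i : Fin n, f (shift^[i] x) = w i})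

/-- The entropy of the shift with respect to a finite measurable partition: the limit of
`joinEntropy μ f n / n`, which exists for invariant `μ`. The sequence takes values in
`[0, log k]`, so that the real `limsup` is a genuine one. -/
def partitionEntropy {d k : ℕ} (μ : Measure (Omega d)) (f : Omega d → Fin k) : ℝ :=
  limsup (fun n : ℕ => joinEntropy μ f n / n) atTop

/-- The Shannon-Kolmogorov entropy `h(μ)`: the supremum of the entropies with respect to all finite
measurable partitions. For invariant `μ` the supremum is over a non-empty set that is bounded
above by `log d`. -/
def entropy {d : ℕ} (μ : Measure (Omega d)) : ℝ :=
  sSup {r : ℝ | ∃ (k : ℕ) (f : Omega d → Fin k), Measurable f ∧ r = partitionEntropy μ f}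

/-- The pressure `P(A) = sup {∫ A dμ + h(μ)}` over all shift-invariant probability measures. For
Hölder (thus bounded) `A` and `d ≥ 1` the set is non-empty and bounded above. -/
def pressure {d : ℕ} (A : Omega d → ℝ) : ℝ :=
  sSup {r : ℝ | ∃ μ : Measure (Omega d), IsInvariantProb μ ∧ r = ∫ x, A x ∂μ + entropy μ}

/-- `μ` is an equilibrium probability for `A`: it is invariant and realizes the supremum in the
definition of the pressure. -/
def IsEquilibrium {d : ℕ} (A : Omega d → ℝ) (μ : Measure (Omega d)) : Prop :=
  IsInvariantProb μ ∧ ∫ x, A x ∂μ + entropy μ = pressure A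

/-- `J` is a Hölder Jacobian: `J > 0`, `log J` is Hölder, and `∑ₐ J(a, b₀, b₁, …) = 1`. -/
structure IsHolderJacobian {d : ℕ} (J : Omega d → ℝ) : Prop where
  pos : ∀ x, 0 < J x
  holder : IsHolder (fun x => Real.log (J x))
  sum_eq_one : ∀ x, ∑ a : Fin d, J (prepend a x) = 1

/-- `μ` is the Hölder Gibbs equilibrium probability with Jacobian `J`. -/
structure IsHolderGibbs {d : ℕ} (J : Omega d → ℝ) (μ : Measure (Omega d)) : Prop where
  jacobian : IsHolderJacobian J
  equilibrium : IsEquilibrium (fun x => Real.log (J x)) μ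

/-- The test statistics `Sₙ(x) = (1/n) ∑_{i < n} log (J₀(σⁱ x) / J₁(σⁱ x))`. -/
def testStat {d : ℕ} (J₀ J₁ : Omega d → ℝ) (n : ℕ) (x : Omega d) : ℝ :=
  (1 / (n : ℝ)) * ∑ i ∈ Finset.range n, Real.log (J₀ (shift^[i] x) / J₁ (shift^[i] x))

/-- The function `t ↦ P(t (log J₀ - log J₁) + log J)`; it is `P_j` when `J = J_j`. -/
def pressureFun {d : ℕ} (J₀ J₁ J : Omega d → ℝ) (t : ℝ) : ℝ :=
  pressure (fun x => t * (Real.log (J₀ x) - Real.log (J₁ x)) + Real.log (J x))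

/-- `c⁺ = sup_t P₁'(t)`; the derivatives are bounded by the supremum norm of
`log J₀ - log J₁`. -/
def cPlus {d : ℕ} (J₀ J₁ : Omega d → ℝ) : ℝ :=
  ⨆ t : ℝ, deriv (pressureFun J₀ J₁ J₁) t

/-- `c⁻ = inf_t P₁'(t)`. -/
def cMinus {d : ℕ} (J₀ J₁ : Omega d → ℝ) : ℝ :=
  ⨅ t : ℝ, deriv (pressureFun J₀ J₁ J₁) t

/-- The deviation function `I(x) = sup_t [t (x + E) - P(t (log J₀ - log J₁) + log J)]`, with values
in `[-∞, ∞]`; it is `I_j` when `J = J_j`. -/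
def deviation {d : ℕ} (J₀ J₁ J : Omega d → ℝ) (E x : ℝ) : EReal :=
  ⨆ t : ℝ, ((t * (x + E) - pressureFun J₀ J₁ J t : ℝ) : EReal)

end HolderGibbs

end

/-! Write φ = log J₀ - log J₁, and let L be the transfer operator of A = log J. The Jacobian
condition says L1 = 1, that is, A is normalized. The proof replaces the variational definition of μ
by the equation L*μ = μ and then runs a Cramér-type argument on Birkhoff sums.

Thermodynamics. Gibbs' inequality against weights exp(Sₙ A) on cylinders gives ∫ A dμ + h(μ) ≤ log
sup L1 for every invariant μ (`integral_add_entropy_le`). If A is normalized, a Doeblin estimate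
makes Lⁿf asymptotically constant, so a fixed measure ν of L* exists (`exists_isGMeasure`). It has
the Gibbs property, hence attains the bound. The pressure has derivative ∫ ψ dν at A in every Hölder
direction ψ (`IsGMeasure.hasDerivAt_pressure`). An equilibrium probability is a subgradient, hence
equals ν (`IsGMeasure.eq_of_isEquilibrium`). Every Hölder potential is normalized up to a coboundary
and a constant, its pressure (`IsHolder.exists_normalized`), so P(t) = P(tφ + A) is differentiable
for all t.

Deviations. Above the mean, tilting by tφ with t ≥ 0 and Chebyshev's inequality give the upper bound
exp(n(P(t) - tE)). For the lower bound, let P'(t) = E' be slightly above E. The fixed measure of the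
normalization of tφ + A has φ-mean E' and concentrates on Sₙφ ≈ nE', and the Gibbs property compares
its cylinders with those of μ. If E exceeds sup P', the rate is infinite and no lower bound is
needed. Statements about μ₀ follow by exchanging J₀ and J₁; parts (i) and (ii) need only the upper
bound. -/

noncomputable section

namespace HolderGibbs

variable {d : ℕ}

/-! ### Hölder functions -/

@[simp] theorem prepend_zero (a : Fin d) (x : Omega d) : prepend a x 0 = a := rfl

@[simp] theorem prepend_succ (a : Fin d) (x : Omega d) (n : ℕ) : prepend a x (n + 1) = x n := rfl

@[simp] theorem shift_prepend (a : Fin d) (x : Omega d) : shift (prepend a x) = x := rfl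

theorem shift_iterate_apply (x : Omega d) (k i : ℕ) : shift^[k] x i = x (i + k) := by
  induction k generalizing x with
  | zero => rfl
  | succ k ih => rw [Function.iterate_succ_apply, ih]; rfl

theorem continuous_shift : Continuous (shift : Omega d → Omega d) :=
  continuous_pi fun n => continuous_apply (n + 1)

theorem IsHolder.exists_nonneg {A : Omega d → ℝ} (h : IsHolder A) :
    ∃ C θ : ℝ, 0 ≤ C ∧ 0 < θ ∧ θ < 1 ∧
      ∀ (n : ℕ) (x y : Omega d), (∀ i < n, x i = y i) → |A x - A y| ≤ C * θ ^ n := by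
  obtain ⟨C, θ, h0, h1, h⟩ := h
  refine ⟨|C|, θ, abs_nonneg C, h0, h1, fun n x y hxy => (h n x y hxy).trans ?_⟩
  gcongr
  exact le_abs_self C

theorem IsHolder.exists_bound {A : Omega d → ℝ} (h : IsHolder A) : ∃ M, 0 ≤ M ∧ ∀ x, |A x| ≤ M := by
  obtain ⟨C, θ, hC, -, -, h⟩ := h.exists_nonneg
  rcases isEmpty_or_nonempty (Omega d) with hE | ⟨⟨x₀⟩⟩
  · exact ⟨0, le_rfl, fun x => hE.elim x⟩
  · refine ⟨|A x₀| + C, by positivity, fun x => ?_⟩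
    have := h 0 x x₀ (by simp)
    have h2 := abs_sub_abs_le_abs_sub (A x) (A x₀)
    simp at this
    linarith

theorem IsHolder.continuous {A : Omega d → ℝ} (h : IsHolder A) : Continuous A := by
  obtain ⟨C, θ, hC, h0, h1, h⟩ := h.exists_nonneg
  rw [continuous_iff_continuousAt]
  intro x
  rw [ContinuousAt, Metric.tendsto_nhds]
  intro ε hε
  have hlim : Tendsto (fun n : ℕ => C * θ ^ n) atTop (𝓝 0) := by
    simpa using (tendsto_pow_atTop_nhds_zero_of_lt_one h0.le h1).const_mul C
  obtain ⟨n, hn⟩ := (hlim.eventually (gt_mem_nhds hε)).exists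
  have : ∀ᶠ y in 𝓝 x, ∀ i ∈ Finset.range n, y i = x i := by
    rw [Filter.eventually_all_finset]
    intro i _
    have := (continuous_apply (A := fun _ : ℕ => Fin d) i).tendsto x
    exact this (by simp : {x i} ∈ 𝓝 (x i))
  filter_upwards [this] with y hy
  rw [Real.dist_eq]
  exact (h n y x fun i hi => hy i (Finset.mem_range.2 hi)).trans_lt hn

theorem IsHolder.integrable {A : Omega d → ℝ} (h : IsHolder A) (μ : Measure (Omega d))
    [IsFiniteMeasure μ] : Integrable A μ := by
  obtain ⟨M, -, hM⟩ := h.exists_bound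
  exact Integrable.of_bound h.continuous.measurable.aestronglyMeasurable M
    (Eventually.of_forall hM)

theorem isHolder_const (c : ℝ) : IsHolder (fun _ : Omega d => c) :=
  ⟨0, 1 / 2, by norm_num, by norm_num, by simp⟩

theorem IsHolder.add {A B : Omega d → ℝ} (hA : IsHolder A) (hB : IsHolder B) :
    IsHolder (fun x => A x + B x) := by
  obtain ⟨C, θ, hC, h0, h1, h⟩ := hA.exists_nonneg
  obtain ⟨C', θ', hC', h0', h1', h'⟩ := hB.exists_nonneg
  refine ⟨C + C', max θ θ', lt_max_of_lt_left h0, max_lt h1 h1', fun n x y hxy => ?_⟩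
  calc |A x + B x - (A y + B y)| = |(A x - A y) + (B x - B y)| := by ring_nf
    _ ≤ |A x - A y| + |B x - B y| := abs_add_le _ _
    _ ≤ C * θ ^ n + C' * θ' ^ n := add_le_add (h n x y hxy) (h' n x y hxy)
    _ ≤ C * max θ θ' ^ n + C' * max θ θ' ^ n := by
      gcongr
      · exact le_max_left _ _
      · exact le_max_right _ _
    _ = _ := by ring

theorem IsHolder.comp_lipschitz {A : Omega d → ℝ} (hA : IsHolder A) {F : ℝ → ℝ} {K : ℝ}
    (hF : ∀ x y, |F (A x) - F (A y)| ≤ K * |A x - A y|) : IsHolder (fun x => F (A x)) := by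
  obtain ⟨C, θ, hC, h0, h1, h⟩ := hA.exists_nonneg
  refine ⟨|K| * C, θ, h0, h1, fun n x y hxy => (hF x y).trans ?_⟩
  rw [mul_assoc]
  exact mul_le_mul (le_abs_self K) (h n x y hxy) (abs_nonneg _) (abs_nonneg _)

theorem IsHolder.const_mul {A : Omega d → ℝ} (hA : IsHolder A) (t : ℝ) :
    IsHolder (fun x => t * A x) :=
  hA.comp_lipschitz (F := fun y => t * y) (K := |t|) fun x y => by
    rw [← mul_sub, abs_mul]

theorem IsHolder.neg {A : Omega d → ℝ} (hA : IsHolder A) : IsHolder (fun x => -A x) := by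
  simpa using hA.const_mul (-1)

theorem IsHolder.sub {A B : Omega d → ℝ} (hA : IsHolder A) (hB : IsHolder B) :
    IsHolder (fun x => A x - B x) := by
  simpa [sub_eq_add_neg] using hA.add hB.neg

/-- By polarization it is enough to treat squares, and squaring is Lipschitz on a bounded range. -/
theorem IsHolder.mul {A B : Omega d → ℝ} (hA : IsHolder A) (hB : IsHolder B) :
    IsHolder (fun x => A x * B x) := by
  have sq : ∀ {A : Omega d → ℝ}, IsHolder A → IsHolder (fun x => A x ^ 2) := by
    intro A hA
    obtain ⟨M, hM0, hM⟩ := hA.exists_bound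
    refine hA.comp_lipschitz (F := fun y => y ^ 2) (K := 2 * M) fun x y => ?_
    rw [sq_sub_sq, abs_mul]
    gcongr
    exact (abs_add_le _ _).trans (by linarith [hM x, hM y])
  have := ((sq (hA.add hB)).sub ((sq hA).add (sq hB))).const_mul (1 / 2)
  convert this using 2
  ring

theorem IsHolder.exp {A : Omega d → ℝ} (hA : IsHolder A) : IsHolder (fun x => Real.exp (A x)) := by
  obtain ⟨M, hM0, hM⟩ := hA.exists_bound
  refine hA.comp_lipschitz (F := Real.exp) (K := Real.exp M) ?_
  have key : ∀ a b : ℝ, a ≤ M → Real.exp a - Real.exp b ≤ Real.exp M * |a - b| := by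
    intro a b ha
    have h1 : Real.exp b = Real.exp a * Real.exp (b - a) := by rw [← Real.exp_add]; ring_nf
    have h2 := Real.add_one_le_exp (b - a)
    have h3 : Real.exp a - Real.exp b ≤ Real.exp a * (a - b) := by
      rw [h1]; nlinarith [Real.exp_pos a]
    have h4 : Real.exp a ≤ Real.exp M := Real.exp_le_exp.2 ha
    calc _ ≤ Real.exp a * (a - b) := h3
      _ ≤ Real.exp a * |a - b| := by gcongr; exact le_abs_self _
      _ ≤ _ := by gcongr
  intro x y
  rw [abs_le']
  refine ⟨key _ _ (abs_le.1 (hM x)).2, ?_⟩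
  rw [neg_sub, abs_sub_comm]
  exact key _ _ (abs_le.1 (hM y)).2

theorem IsHolder.finset_sum {ι : Type*} (s : Finset ι) {A : ι → Omega d → ℝ}
    (hA : ∀ i ∈ s, IsHolder (A i)) : IsHolder (fun x => ∑ i ∈ s, A i x) := by
  classical
  induction s using Finset.induction_on with
  | empty => simpa using isHolder_const 0
  | insert a s ha ih =>
    simp only [Finset.sum_insert ha]
    exact (hA a (by simp)).add (ih fun i hi => hA i (by simp [hi]))

theorem IsHolder.comp_prepend {A : Omega d → ℝ} (hA : IsHolder A) (a : Fin d) :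
    IsHolder (fun x => A (prepend a x)) := by
  obtain ⟨C, θ, hC, h0, h1, h⟩ := hA.exists_nonneg
  refine ⟨C, θ, h0, h1, fun n x y hxy => (h n _ _ fun i hi => ?_)⟩
  rcases i with _ | i
  · rfl
  · exact hxy i (by omega)

theorem IsHolder.comp_shift {A : Omega d → ℝ} (hA : IsHolder A) :
    IsHolder (fun x => A (shift x)) := by
  obtain ⟨C, θ, hC, h0, h1, h⟩ := hA.exists_nonneg
  refine ⟨C / θ, θ, h0, h1, fun n x y hxy => ?_⟩
  rcases n with _ | n
  · refine (h 0 (shift x) (shift y) (by simp)).trans ?_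
    simp only [pow_zero, mul_one]
    exact le_div_self hC h0 h1.le
  · refine (h n (shift x) (shift y) fun i hi => hxy (i + 1) (by omega)).trans (le_of_eq ?_)
    field_simp
    ring

theorem isHolder_of_eq_of_agree {f : Omega d → ℝ} {n : ℕ} {M : ℝ} (hM : ∀ x, |f x| ≤ M)
    (hf : ∀ x y : Omega d, (∀ i < n, x i = y i) → f x = f y) : IsHolder f := by
  refine ⟨2 * |M| / (1 / 2) ^ n, 1 / 2, by norm_num, by norm_num, fun k x y hxy => ?_⟩
  rcases le_or_gt n k with h | h
  · rw [hf x y fun i hi => hxy i (by omega), sub_self, abs_zero]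
    positivity
  · have h1 : |f x - f y| ≤ 2 * |M| := by
      have := abs_sub (f x) (f y)
      have := hM x
      have := hM y
      have := le_abs_self M
      linarith
    refine h1.trans ?_
    rw [div_mul_eq_mul_div, le_div_iff₀ (by positivity)]
    gcongr 2 * |M| * ?_
    exact pow_le_pow_of_le_one (by norm_num) (by norm_num) h.le

/-! ### Birkhoff sums and bounded distortion -/

theorem birkhoffSum_prepend (A : Omega d → ℝ) (n : ℕ) (a : Fin d) (x : Omega d) :
    birkhoffSum shift A (n + 1) (prepend a x) = A (prepend a x) + birkhoffSum shift A n x := by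
  rw [birkhoffSum_succ', shift_prepend]

/-- After i shifts the points still agree in n - i coordinates, so the differences are dominated by
a geometric series, uniformly in n. -/
theorem IsHolder.exists_distortion {A : Omega d → ℝ} (hA : IsHolder A) :
    ∃ D : ℝ, 0 ≤ D ∧ ∀ (n : ℕ) (x y : Omega d), (∀ i < n, x i = y i) →
      |birkhoffSum shift A n x - birkhoffSum shift A n y| ≤ D := by
  obtain ⟨C, θ, hC, h0, h1, h⟩ := hA.exists_nonneg
  have key : ∀ (n : ℕ) (x y : Omega d), (∀ i < n, x i = y i) →
      |birkhoffSum shift A n x - birkhoffSum shift A n y| ≤ C * (1 - θ ^ (n + 1)) / (1 - θ) := by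
    intro n
    induction n with
    | zero => intro x y _; simp; positivity [sub_pos.2 h1]
    | succ n ih =>
      intro x y hxy
      rw [birkhoffSum_succ', birkhoffSum_succ']
      have e1 := h (n + 1) x y hxy
      have e2 := ih (shift x) (shift y) fun i hi => hxy (i + 1) (by omega)
      calc _ = |(A x - A y) + (birkhoffSum shift A n (shift x)
              - birkhoffSum shift A n (shift y))| := by ring_nf
        _ ≤ C * θ ^ (n + 1) + C * (1 - θ ^ (n + 1)) / (1 - θ) := (abs_add_le _ _).trans (by gcongr)
        _ = _ := by
          have : 1 - θ ≠ 0 := by linarith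
          field_simp
          ring
  have h1' : 0 < 1 - θ := by linarith
  refine ⟨C / (1 - θ), by positivity, fun n x y hxy => (key n x y hxy).trans ?_⟩
  gcongr
  have : 0 < θ ^ (n + 1) := by positivity
  nlinarith

theorem birkhoffSum_continuous {A : Omega d → ℝ} (hA : Continuous A) (n : ℕ) :
    Continuous (birkhoffSum shift A n) := by
  unfold birkhoffSum
  exact continuous_finsetSum _ fun i _ => hA.comp (continuous_shift.iterate i)

theorem IsHolder.comp_shift_iterate {A : Omega d → ℝ} (hA : IsHolder A) (n : ℕ) :
    IsHolder (fun x => A (shift^[n] x)) := by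
  induction n with
  | zero => simpa using hA
  | succ n ih => simpa [Function.iterate_succ_apply] using ih.comp_shift

theorem IsHolder.birkhoffSum {A : Omega d → ℝ} (hA : IsHolder A) (n : ℕ) :
    IsHolder (birkhoffSum shift A n) :=
  IsHolder.finset_sum (Finset.range n) fun i _ => hA.comp_shift_iterate i

/-! ### Words and the transfer operator -/

/-- The concatenation of a finite word with a sequence. -/
def cat {n : ℕ} (w : Fin n → Fin d) (x : Omega d) : Omega d :=
  fun i => if h : i < n then w ⟨i, h⟩ else x (i - n)

theorem cat_apply_lt {n : ℕ} (w : Fin n → Fin d) (x : Omega d) {i : ℕ} (h : i < n) :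
    cat w x i = w ⟨i, h⟩ := by
  simp [cat, h]

theorem cat_zero (w : Fin 0 → Fin d) (x : Omega d) : cat w x = x := by
  ext i; simp [cat]

theorem cat_cons {n : ℕ} (a : Fin d) (w : Fin n → Fin d) (x : Omega d) :
    cat (Fin.cons a w : Fin (n + 1) → Fin d) x = prepend a (cat w x) := by
  funext i
  rcases i with _ | i
  · simp [cat]
  · by_cases h : i < n
    · have : i + 1 < n + 1 := by omega
      simp only [cat, h, this, dif_pos, prepend_succ]
      exact Fin.cons_succ (α := fun _ => Fin d) a w ⟨i, h⟩
    · have : ¬ i + 1 < n + 1 := by omega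
      simp [cat, h]

/-- The first `n` letters of a sequence. -/
def word (n : ℕ) (x : Omega d) : Fin n → Fin d := fun i => x i

@[simp] theorem word_cat {n : ℕ} (w : Fin n → Fin d) (x : Omega d) : word n (cat w x) = w := by
  funext i; simp [word, cat]

theorem cat_word_apply {n : ℕ} (x y : Omega d) {i : ℕ} (h : i < n) : cat (word n x) y i = x i := by
  simp [cat, word, h]

theorem cat_agree {n : ℕ} (w : Fin n → Fin d) (x y : Omega d) : ∀ i < n, cat w x i = cat w y i :=
  fun i hi => by rw [cat_apply_lt w x hi, cat_apply_lt w y hi]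

theorem measurable_word (n : ℕ) : Measurable (word n : Omega d → Fin n → Fin d) :=
  measurable_pi_lambda _ fun i => measurable_pi_apply (i : ℕ)

/-- The transfer (Ruelle) operator of the potential `A`. -/
def transfer (A f : Omega d → ℝ) (x : Omega d) : ℝ :=
  ∑ a : Fin d, Real.exp (A (prepend a x)) * f (prepend a x)

/-- The points `cat w x` are the preimages of x under the n-th iterate of the shift. -/
theorem transfer_iterate (A f : Omega d → ℝ) (n : ℕ) (x : Omega d) :
    (transfer A)^[n] f x =
      ∑ w : Fin n → Fin d, Real.exp (birkhoffSum shift A n (cat w x)) * f (cat w x) := by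
  induction n generalizing f with
  | zero => simp [cat_zero]
  | succ n ih =>
    rw [Function.iterate_succ_apply, ih,
      ← (Fin.consEquiv fun _ : Fin (n + 1) => Fin d).sum_comp, Fintype.sum_prod_type_right]
    refine Finset.sum_congr rfl fun w _ => ?_
    rw [transfer, Finset.mul_sum]
    refine Finset.sum_congr rfl fun a _ => ?_
    rw [← mul_assoc, ← Real.exp_add]
    have : (Fin.consEquiv fun _ : Fin (n + 1) => Fin d) (a, w)
      = (Fin.cons a w : Fin (n + 1) → Fin d) := rfl
    rw [this, cat_cons, birkhoffSum_prepend, add_comm]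

theorem IsHolder.transfer {A f : Omega d → ℝ} (hA : IsHolder A) (hf : IsHolder f) :
    IsHolder (transfer A f) :=
  IsHolder.finset_sum _ fun a _ => (hA.comp_prepend a).exp.mul (hf.comp_prepend a)

theorem IsHolder.transfer_iterate {A f : Omega d → ℝ} (hA : IsHolder A) (hf : IsHolder f) (n : ℕ) :
    IsHolder ((HolderGibbs.transfer A)^[n] f) := by
  induction n with
  | zero => exact hf
  | succ n ih => rw [Function.iterate_succ_apply']; exact hA.transfer ih

theorem transfer_mono (A : Omega d → ℝ) {f g : Omega d → ℝ} (h : ∀ x, f x ≤ g x) (x : Omega d) :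
    transfer A f x ≤ transfer A g x :=
  Finset.sum_le_sum fun _ _ => mul_le_mul_of_nonneg_left (h _) (Real.exp_pos _).le

theorem transfer_const_mul (A f : Omega d → ℝ) (c : ℝ) (x : Omega d) :
    transfer A (fun y => c * f y) x = c * transfer A f x := by
  simp only [transfer, Finset.mul_sum]
  exact Finset.sum_congr rfl fun a _ => by ring

theorem transfer_iterate_one_le {A : Omega d → ℝ} {c : ℝ}
    (h : ∀ x, transfer A (fun _ => 1) x ≤ Real.exp c) (n : ℕ) (x : Omega d) :
    (transfer A)^[n] (fun _ => 1) x ≤ Real.exp (n * c) := by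
  induction n generalizing x with
  | zero => simp
  | succ n ih =>
    rw [Function.iterate_succ_apply']
    refine (transfer_mono A ih x).trans ?_
    have := transfer_const_mul A (fun _ => 1) (Real.exp (n * c)) x
    simp only [mul_one] at this
    rw [this]
    calc _ ≤ Real.exp (n * c) * Real.exp c := by gcongr; exact h x
      _ = _ := by rw [← Real.exp_add]; push_cast; ring_nf

/-! ### Entropy: elementary bounds -/

theorem integral_comp_eq_sum {Ω ι : Type*} [MeasurableSpace Ω] [Fintype ι] [MeasurableSpace ι]
    [MeasurableSingletonClass ι] (μ : Measure Ω) [IsFiniteMeasure μ] {F : Ω → ι}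
    (hF : Measurable F) (φ : ι → ℝ) :
    ∫ x, φ (F x) ∂μ = ∑ i, μ.real (F ⁻¹' {i}) * φ i := by
  rw [← integral_map (φ := F) hF.aemeasurable (f := φ) (by fun_prop),
    integral_fintype Integrable.of_finite]
  refine Finset.sum_congr rfl fun i _ => ?_
  rw [map_measureReal_apply hF (measurableSet_singleton i), smul_eq_mul]

/-- Gibbs' inequality. -/
theorem sum_negMulLog_le_integral {Ω ι : Type*} [MeasurableSpace Ω] [Fintype ι]
    [MeasurableSpace ι] [MeasurableSingletonClass ι] (μ : Measure Ω) [IsProbabilityMeasure μ]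
    {F : Ω → ι} (hF : Measurable F) {q : ι → ℝ} (hq : ∀ i, 0 < q i) (hq1 : ∑ i, q i ≤ 1) :
    ∑ i, Real.negMulLog (μ.real (F ⁻¹' {i})) ≤ ∫ x, -Real.log (q (F x)) ∂μ := by
  rw [integral_comp_eq_sum μ hF fun i => -Real.log (q i)]
  have h1 : ∑ i, μ.real (F ⁻¹' {i}) = 1 := by
    have := integral_comp_eq_sum μ hF fun _ => 1
    simpa using this.symm
  -- This is log s ≤ s - 1 at s = q/p; after summation the corrections q - p contribute at most 0.
  have key : ∀ i, Real.negMulLog (μ.real (F ⁻¹' {i})) ≤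
      μ.real (F ⁻¹' {i}) * -Real.log (q i) + (q i - μ.real (F ⁻¹' {i})) := by
    intro i
    rcases (measureReal_nonneg (μ := μ) (s := F ⁻¹' {i})).eq_or_lt with h | h
    · simp [← h, (hq i).le]
    · have h2 := Real.add_one_le_exp (Real.log (q i / μ.real (F ⁻¹' {i})))
      rw [Real.exp_log (div_pos (hq i) h), Real.log_div (hq i).ne' h.ne', le_div_iff₀ h] at h2
      rw [Real.negMulLog]
      linarith
  calc _ ≤ ∑ i, (μ.real (F ⁻¹' {i}) * -Real.log (q i) + (q i - μ.real (F ⁻¹' {i}))) :=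
        Finset.sum_le_sum fun i _ => key i
    _ ≤ _ := by rw [Finset.sum_add_distrib, Finset.sum_sub_distrib]; linarith

/-- The `f`-itinerary of length `n`. -/
def itinerary {k : ℕ} (f : Omega d → Fin k) (n : ℕ) (x : Omega d) : Fin n → Fin k :=
  fun i => f (shift^[i] x)

theorem measurable_itinerary {k : ℕ} {f : Omega d → Fin k} (hf : Measurable f) (n : ℕ) :
    Measurable (itinerary f n) :=
  measurable_pi_lambda _ fun i => hf.comp (continuous_shift.measurable.iterate i)

theorem joinEntropy_eq {k : ℕ} (μ : Measure (Omega d)) (f : Omega d → Fin k) (n : ℕ) :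
    joinEntropy μ f n =
      ∑ w : Fin n → Fin k, Real.negMulLog (μ.real (itinerary f n ⁻¹' {w})) := by
  refine Finset.sum_congr rfl fun w _ => ?_
  congr 2
  ext x
  simp [itinerary, funext_iff]

theorem joinEntropy_nonneg {k : ℕ} (μ : Measure (Omega d)) [IsProbabilityMeasure μ]
    (f : Omega d → Fin k) (n : ℕ) : 0 ≤ joinEntropy μ f n :=
  Finset.sum_nonneg fun _ _ => Real.negMulLog_nonneg measureReal_nonneg measureReal_le_one

theorem joinEntropy_le {k : ℕ} (μ : Measure (Omega d)) [IsProbabilityMeasure μ]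
    {f : Omega d → Fin k} (hf : Measurable f) (n : ℕ) : joinEntropy μ f n ≤ n * Real.log k := by
  rw [joinEntropy_eq]
  have hk : 0 < k := by
    obtain ⟨x⟩ := nonempty_of_isProbabilityMeasure μ
    exact (f x).pos
  have hk' : (0 : ℝ) < k := by exact_mod_cast hk
  have := sum_negMulLog_le_integral μ (measurable_itinerary hf n) (q := fun _ => ((k : ℝ) ^ n)⁻¹)
    (fun _ => by positivity) (by simp [hk'.ne'])
  simpa using this

theorem isBoundedUnder_joinEntropy {k : ℕ} (μ : Measure (Omega d)) [IsProbabilityMeasure μ]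
    {f : Omega d → Fin k} (hf : Measurable f) :
    IsBoundedUnder (· ≤ ·) atTop fun n : ℕ => joinEntropy μ f n / n := by
  refine isBoundedUnder_of ⟨Real.log k, fun n => ?_⟩
  refine div_le_of_le_mul₀ (by positivity) (Real.log_natCast_nonneg k) ?_
  rw [mul_comm]
  exact joinEntropy_le μ hf n

theorem isCoboundedUnder_joinEntropy {k : ℕ} (μ : Measure (Omega d)) [IsProbabilityMeasure μ]
    (f : Omega d → Fin k) :
    IsCoboundedUnder (· ≤ ·) atTop fun n : ℕ => joinEntropy μ f n / n := by
  refine IsBoundedUnder.isCoboundedUnder_le (isBoundedUnder_of ⟨0, fun n => ?_⟩)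
  exact div_nonneg (joinEntropy_nonneg μ f n) (by positivity)

/-! ### Approximation of partitions by cylinders -/

/-- The cylinders form an algebra generating the σ-algebra, hence are dense for the measure of
symmetric differences; each depends on finitely many coordinates. -/
theorem exists_cylinder_approx (μ : Measure (Omega d)) [IsProbabilityMeasure μ] {s : Set (Omega d)}
    (hs : MeasurableSet s) {δ : ℝ} (hδ : 0 < δ) :
    ∃ (m : ℕ) (t : Set (Omega d)), MeasurableSet t ∧ μ.real (symmDiff s t) < δ ∧
      ∀ x y : Omega d, (∀ i < m, x i = y i) → (x ∈ t ↔ y ∈ t) := by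
  have hd := Measure.MeasureDense.of_generateFrom_isSetAlgebra_finite (μ := μ)
    (isSetAlgebra_measurableCylinders (α := fun _ : ℕ => Fin d))
    generateFrom_measurableCylinders.symm
  obtain ⟨t, ht, hst⟩ := hd.approx s hs (measure_ne_top _ _) δ hδ
  obtain ⟨I, S, hS, rfl⟩ := (mem_measurableCylinders _).mp ht
  refine ⟨I.sup id + 1, _, hd.measurable _ ht, ?_, fun x y hxy => ?_⟩
  · rw [measureReal_def]
    exact (ENNReal.lt_ofReal_iff_toReal_lt (measure_ne_top _ _)).1 hst
  · have : I.restrict x = I.restrict y := by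
      funext i
      exact hxy i (Nat.lt_succ_of_le (Finset.le_sup (f := id) i.2))
    simp [mem_cylinder, this]

theorem exists_cylinder_partition_approx (μ : Measure (Omega d)) [IsProbabilityMeasure μ] {k : ℕ}
    {f : Omega d → Fin k} (hf : Measurable f) {δ : ℝ} (hδ : 0 < δ) :
    ∃ (m : ℕ) (G : Omega d → Fin k), Measurable G ∧ μ.real {x | f x ≠ G x} ≤ δ ∧
      ∀ x y : Omega d, (∀ i < m, x i = y i) → G x = G y := by
  classical
  have hk : 0 < k := by
    obtain ⟨x⟩ := nonempty_of_isProbabilityMeasure μ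
    exact (f x).pos
  have hk' : (0 : ℝ) < k := by exact_mod_cast hk
  choose m t ht hst hag using fun j : Fin k =>
    exists_cylinder_approx μ (hf (measurableSet_singleton j)) (div_pos hδ hk')
  let p : Omega d → Finset (Fin k) := fun x => Finset.univ.filter fun j => x ∈ t j
  -- The sets `t j` need neither be disjoint nor cover. The least admissible index, or 0 by default,
  -- is taken; it is wrong only where some `t j` differs from the fibre of `f` over j.
  let G : Omega d → Fin k := fun x => if h : (p x).Nonempty then (p x).min' h else ⟨0, hk⟩
  have hGp : ∀ x y, p x = p y → G x = G y := by
    intro x y h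
    simp only [G, h]
  have hag' : ∀ x y : Omega d, (∀ i < Finset.univ.sup m, x i = y i) → G x = G y := by
    intro x y hxy
    refine hGp x y ?_
    ext j
    simp only [p, Finset.mem_filter, Finset.mem_univ, true_and]
    exact hag j x y fun i hi => hxy i (hi.trans_le (Finset.le_sup (Finset.mem_univ j)))
  refine ⟨Finset.univ.sup m, G, ?_, ?_, hag'⟩
  · obtain ⟨x₀⟩ := nonempty_of_isProbabilityMeasure μ
    have : G = (fun w => G (cat w x₀)) ∘ word (Finset.univ.sup m) := by
      funext x
      exact hag' _ _ fun i hi => (cat_word_apply x x₀ hi).symm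
    rw [this]
    exact (measurable_of_finite _).comp (measurable_word _)
  · have hsub : {x | f x ≠ G x} ⊆ ⋃ j ∈ Finset.univ, symmDiff (f ⁻¹' {j}) (t j) := by
      intro x hx
      by_contra hcon
      simp only [Finset.mem_univ, Set.iUnion_true, Set.mem_iUnion, not_exists,
        Set.mem_symmDiff] at hcon
      apply hx
      have hp : p x = {f x} := by
        ext j
        have := hcon j
        simp only [p, Finset.mem_filter, Finset.mem_univ, true_and, Finset.mem_singleton]
        simp only [Set.mem_preimage, Set.mem_singleton_iff] at this
        constructor
        · intro h; by_contra h'; exact this (Or.inr ⟨h, fun e => h' e.symm⟩)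
        · intro h; by_contra h'; exact this (Or.inl ⟨h.symm, h'⟩)
      simp [G, hp]
    calc μ.real {x | f x ≠ G x}
        ≤ μ.real (⋃ j ∈ Finset.univ, symmDiff (f ⁻¹' {j}) (t j)) :=
          measureReal_mono hsub (measure_ne_top _ _)
      _ ≤ ∑ j, μ.real (symmDiff (f ⁻¹' {j}) (t j)) := measureReal_biUnion_finset_le _ _
      _ ≤ ∑ _j : Fin k, δ / k := Finset.sum_le_sum fun j _ => (hst j).le
      _ = δ := by simp; field_simp

/-! ### The upper bound for the pressure -/

theorem integral_birkhoffSum {μ : Measure (Omega d)} (hμ : IsInvariantProb μ) {φ : Omega d → ℝ}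
    (hφ : Integrable φ μ) (n : ℕ) :
    Integrable (birkhoffSum shift φ n) μ ∧ ∫ x, birkhoffSum shift φ n x ∂μ = n * ∫ x, φ x ∂μ := by
  have hi : ∀ i, Integrable (fun x => φ (shift^[i] x)) μ := fun i =>
    (hμ.2.iterate i).integrable_comp_of_integrable hφ
  have he : ∀ i, ∫ x, φ (shift^[i] x) ∂μ = ∫ x, φ x ∂μ := fun i => by
    have h := (hμ.2.iterate i).map_eq
    rw [← integral_map (φ := shift^[i]) (f := φ) (hμ.2.iterate i).measurable.aemeasurable
      (by rw [h]; exact hφ.aestronglyMeasurable), h]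
  unfold birkhoffSum
  refine ⟨integrable_finsetSum _ fun i _ => hi i, ?_⟩
  rw [integral_finsetSum _ fun i _ => hi i]
  simp [he]

/-- A smoothed version of the identity matrix on `Fin k`. -/
def smoothDiag (k : ℕ) (ε : ℝ) (i j : Fin k) : ℝ := if i = j then 1 - ε else ε / k

theorem smoothDiag_pos {k : ℕ} {ε : ℝ} (h0 : 0 < ε) (h1 : ε < 1) (i j : Fin k) :
    0 < smoothDiag k ε i j := by
  unfold smoothDiag
  have hk : (0 : ℝ) < k := by exact_mod_cast i.pos
  split_ifs
  · linarith
  · positivity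

theorem sum_smoothDiag_le {k : ℕ} {ε : ℝ} (h0 : 0 < ε) (j : Fin k) :
    ∑ i, smoothDiag k ε i j ≤ 1 := by
  have hk : (0 : ℝ) < k := by exact_mod_cast j.pos
  calc ∑ i, smoothDiag k ε i j ≤ ∑ i, ((if i = j then 1 - ε else 0) + ε / k) := by
        refine Finset.sum_le_sum fun i _ => ?_
        unfold smoothDiag
        split_ifs
        · have : 0 < ε / k := by positivity
          linarith
        · simp
    _ = 1 := by
      rw [Finset.sum_add_distrib]
      simp
      field_simp
      ring

/-- Gibbs' inequality is applied to a subprobability `q` on `f`-itineraries: pick a word of length n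
+ m with weight `T`, follow its `G`-itinerary, and corrupt each letter by `smoothDiag`. The m extra
letters are needed because `G`, evaluated after fewer than n shifts, reads up to n + m coordinates.
-/
theorem joinEntropy_le_of_agree {A : Omega d → ℝ} {c D : ℝ}
    (hD : ∀ (n : ℕ) (x y : Omega d), (∀ i < n, x i = y i) →
      |birkhoffSum shift A n x - birkhoffSum shift A n y| ≤ D)
    (hc : ∀ x, transfer A (fun _ => 1) x ≤ Real.exp c)
    {μ : Measure (Omega d)} (hμ : IsInvariantProb μ) (hA : Integrable A μ) {k m : ℕ}
    {f G : Omega d → Fin k} (hf : Measurable f) (hG : Measurable G)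
    (hag : ∀ x y : Omega d, (∀ i < m, x i = y i) → G x = G y) {ε : ℝ} (h0 : 0 < ε) (h1 : ε < 1)
    (n : ℕ) :
    joinEntropy μ f n ≤ D + (n + m) * (c - ∫ x, A x ∂μ) +
      n * ∫ x, -Real.log (smoothDiag k ε (f x) (G x)) ∂μ := by
  have := hμ.1
  obtain ⟨y⟩ := nonempty_of_isProbabilityMeasure μ
  set N := n + m with hN
  let T : (Fin N → Fin d) → ℝ := fun w =>
    Real.exp (birkhoffSum shift A N (cat w y) - N * c)
  let R : (Fin n → Fin k) → (Fin N → Fin d) → ℝ := fun v w =>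
    ∏ i : Fin n, smoothDiag k ε (v i) (G (shift^[i] (cat w y)))
  let q : (Fin n → Fin k) → ℝ := fun v => ∑ w, T w * R v w
  have hT : ∀ w, 0 < T w := fun w => Real.exp_pos _
  have hR : ∀ v w, 0 < R v w := fun v w => Finset.prod_pos fun i _ => smoothDiag_pos h0 h1 _ _
  have hqT : ∀ v w, T w * R v w ≤ q v := fun v w =>
    Finset.single_le_sum (f := fun w => T w * R v w)
      (fun w _ => (mul_pos (hT w) (hR v w)).le) (Finset.mem_univ w)
  have hq : ∀ v, 0 < q v := fun v => (mul_pos (hT (word N y)) (hR v _)).trans_le (hqT v _)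
  have hT1 : ∑ w, T w ≤ 1 := by
    have := transfer_iterate_one_le hc N y
    rw [transfer_iterate] at this
    simp only [T, Real.exp_sub, ← Finset.sum_div]
    rw [div_le_one (Real.exp_pos _)]
    simpa using this
  have hR1 : ∀ w, ∑ v, R v w ≤ 1 := by
    intro w
    have : ∑ v, R v w = ∏ i : Fin n, ∑ j, smoothDiag k ε j (G (shift^[i] (cat w y))) := by
      rw [Finset.prod_univ_sum, Fintype.piFinset_univ]
    rw [this]
    exact Finset.prod_le_one
      (fun i _ => Finset.sum_nonneg fun j _ => (smoothDiag_pos h0 h1 _ _).le)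
      fun i _ => sum_smoothDiag_le h0 _
  have hq1 : ∑ v, q v ≤ 1 := by
    rw [Finset.sum_comm]
    refine le_trans (Finset.sum_le_sum fun w _ => ?_) hT1
    rw [← Finset.mul_sum]
    exact mul_le_of_le_one_right (hT w).le (hR1 w)
  rw [joinEntropy_eq]
  refine (sum_negMulLog_le_integral μ (measurable_itinerary hf n) hq hq1).trans ?_
  let ψ : Omega d → ℝ := fun x => -Real.log (smoothDiag k ε (f x) (G x))
  have hψ : Integrable ψ μ := by
    have : ψ = (fun p : Fin k × Fin k => -Real.log (smoothDiag k ε p.1 p.2)) ∘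
      fun x => (f x, G x) := rfl
    have hm : Measurable fun x => (f x, G x) := hf.prodMk hG
    rw [this]
    refine Integrable.comp_measurable ?_ hm
    exact Integrable.of_finite
  obtain ⟨hi1, he1⟩ := integral_birkhoffSum hμ hA N
  obtain ⟨hi2, he2⟩ := integral_birkhoffSum hμ hψ n
  -- Only the summand of `q` that comes from the word of x itself is kept.
  have hpt : ∀ x, -Real.log (q (itinerary f n x)) ≤
      (D + N * c - birkhoffSum shift A N x) + birkhoffSum shift ψ n x := by
    intro x
    have e1 := Real.log_le_log (mul_pos (hT (word N x)) (hR (itinerary f n x) (word N x)))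
      (hqT (itinerary f n x) (word N x))
    rw [Real.log_mul (hT _).ne' (hR _ _).ne', Real.log_exp,
      Real.log_prod (fun i _ => (smoothDiag_pos h0 h1 _ _).ne')] at e1
    have e2 := (abs_le.1 (hD N (cat (word N x) y) x fun i hi => cat_word_apply x y hi)).1
    have e3 : birkhoffSum shift ψ n x = -∑ i : Fin n, Real.log (smoothDiag k ε
        (itinerary f n x i) (G (shift^[i] (cat (word N x) y)))) := by
      rw [birkhoffSum, ← Fin.sum_univ_eq_sum_range (fun i => ψ (shift^[i] x)),
        ← Finset.sum_neg_distrib]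
      refine Finset.sum_congr rfl fun i _ => ?_
      have : G (shift^[i] (cat (word N x) y)) = G (shift^[i] x) := by
        refine hag _ _ fun j hj => ?_
        rw [shift_iterate_apply, shift_iterate_apply, cat_word_apply]
        have := i.2
        omega
      rw [this]
      rfl
    linarith
  have hi3 : Integrable (fun x => D + N * c - birkhoffSum shift A N x) μ :=
    (integrable_const _).sub hi1
  have hint : Integrable (fun x => (D + N * c - birkhoffSum shift A N x) +
      birkhoffSum shift ψ n x) μ := hi3.add hi2
  calc ∫ x, -Real.log (q (itinerary f n x)) ∂μ
      ≤ ∫ x, ((D + N * c - birkhoffSum shift A N x) + birkhoffSum shift ψ n x) ∂μ := by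
        refine integral_mono ?_ hint hpt
        exact (Integrable.of_finite (f := fun v => -Real.log (q v))).comp_measurable
          (measurable_itinerary hf n)
    _ = _ := by
      rw [integral_add hi3 hi2, integral_sub (integrable_const _) hi1,
        he1, he2]
      simp [hN]
      ring

theorem integral_smoothDiag_le (μ : Measure (Omega d)) [IsProbabilityMeasure μ] {k : ℕ}
    {f G : Omega d → Fin k} (hf : Measurable f) (hG : Measurable G) {ε δ : ℝ} (h0 : 0 < ε)
    (h1 : ε < 1) (hδ : μ.real {x | f x ≠ G x} ≤ δ) :
    ∫ x, -Real.log (smoothDiag k ε (f x) (G x)) ∂μ ≤ -Real.log (1 - ε) + δ * -Real.log (ε / k) := by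
  have hk : 0 < k := by
    obtain ⟨x⟩ := nonempty_of_isProbabilityMeasure μ
    exact (f x).pos
  have hk1 : (1 : ℝ) ≤ k := by exact_mod_cast hk
  have hs : MeasurableSet {x | f x ≠ G x} := (measurableSet_eq_fun hf hG).compl
  have hlog : 0 ≤ -Real.log (ε / k) := by
    rw [neg_nonneg]
    exact Real.log_nonpos (by positivity) ((div_le_self h0.le hk1).trans h1.le)
  have hlog1 : 0 ≤ -Real.log (1 - ε) := by
    rw [neg_nonneg]
    exact Real.log_nonpos (by linarith) (by linarith)
  have hint : Integrable ({x | f x ≠ G x}.indicator fun _ => -Real.log (ε / k)) μ :=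
    (integrable_const _).indicator hs
  calc ∫ x, -Real.log (smoothDiag k ε (f x) (G x)) ∂μ
      ≤ ∫ x, (-Real.log (1 - ε) + {x | f x ≠ G x}.indicator (fun _ => -Real.log (ε / k)) x) ∂μ := by
        refine integral_mono_of_nonneg (Eventually.of_forall fun x => ?_)
          ((integrable_const _).add hint) (Eventually.of_forall fun x => ?_)
        · simp only [smoothDiag, Pi.zero_apply]
          split_ifs <;> assumption
        · simp only [smoothDiag]
          split_ifs with h
          · simp [h]
          · simp [h, hlog1]
    _ = -Real.log (1 - ε) + μ.real {x | f x ≠ G x} * -Real.log (ε / k) := by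
      rw [integral_add (integrable_const _) hint, integral_indicator_const _ hs]
      simp
    _ ≤ _ := by gcongr

/-- The variational upper bound: the free energy of an invariant measure, with respect to any finite
partition, is at most the logarithm of the supremum of the transfer operator applied to `1`. -/
theorem integral_add_partitionEntropy_le {A : Omega d → ℝ} (hA : IsHolder A) {c : ℝ}
    (hc : ∀ x, transfer A (fun _ => 1) x ≤ Real.exp c)
    {μ : Measure (Omega d)} (hμ : IsInvariantProb μ) {k : ℕ} {f : Omega d → Fin k}
    (hf : Measurable f) : ∫ x, A x ∂μ + partitionEntropy μ f ≤ c := by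
  have := hμ.1
  have hk : 0 < k := by
    obtain ⟨x⟩ := nonempty_of_isProbabilityMeasure μ
    exact (f x).pos
  have hk' : (0 : ℝ) < k := by exact_mod_cast hk
  obtain ⟨D, -, hD⟩ := hA.exists_distortion
  have hAi := hA.integrable μ
  -- Division by n removes D and the m extra letters. Then δ tends to 0 with ε fixed, which kills
  -- the term with log (ε / k), and finally ε tends to 0.
  have step : ∀ ε δ : ℝ, 0 < ε → ε < 1 → 0 < δ →
      ∫ x, A x ∂μ + partitionEntropy μ f ≤ c + (-Real.log (1 - ε) + δ * -Real.log (ε / k)) := by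
    intro ε δ h0 h1 hδ
    obtain ⟨m, G, hG, hfG, hag⟩ := exists_cylinder_partition_approx μ hf hδ
    have hb := integral_smoothDiag_le μ hf hG h0 h1 hfG
    set b := -Real.log (1 - ε) + δ * -Real.log (ε / k)
    set a := c - ∫ x, A x ∂μ with ha
    have hle : ∀ᶠ n : ℕ in atTop, joinEntropy μ f n / n ≤ (D + m * a) / n + (a + b) := by
      filter_upwards [eventually_gt_atTop 0] with n hn
      have hn' : (0 : ℝ) < n := by exact_mod_cast hn
      have := joinEntropy_le_of_agree hD hc hμ hAi hf hG hag h0 h1 n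
      rw [div_add' _ _ _ hn'.ne']
      gcongr
      nlinarith
    have hlim : Tendsto (fun n : ℕ => (D + m * a) / n + (a + b)) atTop (𝓝 (a + b)) := by
      simpa using (tendsto_const_div_atTop_nhds_zero_nat (D + m * a)).add_const (a + b)
    have := limsup_le_limsup hle (isCoboundedUnder_joinEntropy μ f) hlim.isBoundedUnder_le
    rw [hlim.limsup_eq] at this
    rw [partitionEntropy]
    linarith
  have step2 : ∀ ε : ℝ, 0 < ε → ε < 1 →
      ∫ x, A x ∂μ + partitionEntropy μ f ≤ c - Real.log (1 - ε) := by
    intro ε h0 h1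
    have hlim : Tendsto (fun δ : ℝ => c + (-Real.log (1 - ε) + δ * -Real.log (ε / k))) (𝓝[>] 0)
        (𝓝 (c + (-Real.log (1 - ε) + 0 * -Real.log (ε / k)))) := by
      refine Tendsto.mono_left (Continuous.tendsto ?_ 0) nhdsWithin_le_nhds
      fun_prop
    have := ge_of_tendsto hlim (eventually_mem_nhdsWithin.mono fun δ hδ => step ε δ h0 h1 hδ)
    linarith
  have hlim : Tendsto (fun ε : ℝ => c - Real.log (1 - ε)) (𝓝[>] 0) (𝓝 (c - Real.log (1 - 0))) := by
    refine Tendsto.mono_left ?_ nhdsWithin_le_nhds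
    have : ContinuousAt (fun ε : ℝ => c - Real.log (1 - ε)) 0 := by
      refine continuousAt_const.sub (ContinuousAt.log (by fun_prop) (by norm_num))
    exact this
  have := ge_of_tendsto hlim (by
    filter_upwards [eventually_mem_nhdsWithin, nhdsWithin_le_nhds (gt_mem_nhds one_pos)]
      with ε h0 h1 using step2 ε h0 h1)
  simpa using this

/-- The variational bound for the zero potential bounds all partition entropies by log d, so the
real `sSup` is a genuine supremum. -/
theorem partitionEntropy_le_entropy [NeZero d] {μ : Measure (Omega d)} (hμ : IsInvariantProb μ)
    {k : ℕ} {f : Omega d → Fin k} (hf : Measurable f) : partitionEntropy μ f ≤ entropy μ := by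
  have hd : (0 : ℝ) < d := by exact_mod_cast NeZero.pos d
  refine le_csSup ⟨Real.log d, ?_⟩ ⟨k, f, hf, rfl⟩
  rintro _ ⟨k, f, hf, rfl⟩
  have := integral_add_partitionEntropy_le (d := d) (isHolder_const 0) (c := Real.log d)
    (fun x => by simp [transfer, Real.exp_log hd]) hμ hf
  simpa using this

theorem integral_add_entropy_le [NeZero d] {A : Omega d → ℝ} (hA : IsHolder A) {c : ℝ}
    (hc : ∀ x, transfer A (fun _ => 1) x ≤ Real.exp c)
    {μ : Measure (Omega d)} (hμ : IsInvariantProb μ) : ∫ x, A x ∂μ + entropy μ ≤ c := by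
  have : entropy μ ≤ c - ∫ x, A x ∂μ := by
    refine csSup_le ⟨_, d, fun x => x 0, measurable_pi_apply 0, rfl⟩ ?_
    rintro _ ⟨k, f, hf, rfl⟩
    have := integral_add_partitionEntropy_le hA hc hμ hf
    linarith
  linarith

/-! ### Normalized potentials: convergence of the iterates of the transfer operator -/

/-- `A` is normalized if its transfer operator fixes the constants. -/
def IsNormalized (A : Omega d → ℝ) : Prop := ∀ x, transfer A (fun _ => 1) x = 1

theorem IsNormalized.sum_exp {A : Omega d → ℝ} (hN : IsNormalized A) (x : Omega d) :
    ∑ a : Fin d, Real.exp (A (prepend a x)) = 1 := by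
  simpa [transfer] using hN x

theorem IsNormalized.nonpos {A : Omega d → ℝ} (hN : IsNormalized A) (x : Omega d) : A x ≤ 0 := by
  have hx : prepend (x 0) (shift x) = x := by
    funext i; rcases i with _ | i <;> rfl
  have := Finset.single_le_sum (f := fun a : Fin d => Real.exp (A (prepend a (shift x))))
    (fun a _ => (Real.exp_pos _).le) (Finset.mem_univ (x 0))
  rw [hN.sum_exp] at this
  simp only [hx] at this
  exact Real.exp_le_one_iff.1 this

theorem IsNormalized.transfer_const {A : Omega d → ℝ} (hN : IsNormalized A) (c : ℝ) (x : Omega d) :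
    transfer A (fun _ => c) x = c := by
  have := transfer_const_mul A (fun _ => 1) c x
  rw [hN x] at this
  simpa using this

theorem IsNormalized.iterate_one {A : Omega d → ℝ} (hN : IsNormalized A) (n : ℕ) (x : Omega d) :
    (transfer A)^[n] (fun _ => 1) x = 1 := by
  have : transfer A (fun _ => 1) = fun _ => 1 := funext fun x => hN x
  rw [Function.iterate_fixed this]

theorem IsNormalized.sum_exp_birkhoffSum {A : Omega d → ℝ} (hN : IsNormalized A) (n : ℕ)
    (x : Omega d) :
    ∑ w : Fin n → Fin d, Real.exp (birkhoffSum shift A n (cat w x)) = 1 := by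
  have := hN.iterate_one n x
  rw [transfer_iterate] at this
  simpa using this

theorem IsNormalized.le_transfer {A f : Omega d → ℝ} (hN : IsNormalized A) {c : ℝ}
    (h : ∀ x, c ≤ f x) (x : Omega d) : c ≤ transfer A f x :=
  (hN.transfer_const c x).symm.trans_le (transfer_mono A h x)

theorem IsNormalized.transfer_le {A f : Omega d → ℝ} (hN : IsNormalized A) {c : ℝ}
    (h : ∀ x, f x ≤ c) (x : Omega d) : transfer A f x ≤ c :=
  (transfer_mono A h x).trans_eq (hN.transfer_const c x)

theorem IsNormalized.abs_iterate_le {A f : Omega d → ℝ} (hN : IsNormalized A) {M : ℝ}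
    (h : ∀ x, |f x| ≤ M) (n : ℕ) (x : Omega d) : |(transfer A)^[n] f x| ≤ M := by
  induction n generalizing x with
  | zero => exact h x
  | succ n ih =>
    rw [Function.iterate_succ_apply', abs_le]
    exact ⟨hN.le_transfer (fun x => (abs_le.1 (ih x)).1) x,
      hN.transfer_le (fun x => (abs_le.1 (ih x)).2) x⟩

theorem IsNormalized.iterate_sub_le {A f : Omega d → ℝ} (hN : IsNormalized A) {R : ℝ}
    (h : ∀ x y, f x - f y ≤ R) (n : ℕ) (x y : Omega d) :
    (transfer A)^[n] f x - (transfer A)^[n] f y ≤ R := by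
  induction n generalizing x y with
  | zero => exact h x y
  | succ n ih =>
    rw [Function.iterate_succ_apply']
    have : ∀ y, transfer A ((transfer A)^[n] f) x - R ≤ (transfer A)^[n] f y := fun y => by
      have := hN.transfer_le (f := (transfer A)^[n] f) (c := (transfer A)^[n] f y + R)
        (fun x => by linarith [ih x y]) x
      linarith
    linarith [hN.le_transfer this y]

/-- Prepending a letter gains a factor θ on the variation of the iterate, while the variation of the
d weights costs at most d C M θ. The constant `H` is chosen so that Hθ + d C M θ ≤ H, whence it
survives every iteration. -/
theorem IsNormalized.exists_uniform_holder {A f : Omega d → ℝ} (hN : IsNormalized A)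
    (hA : IsHolder A) (hf : IsHolder f) :
    ∃ H θ : ℝ, 0 ≤ H ∧ 0 < θ ∧ θ < 1 ∧ ∀ (m n : ℕ) (x y : Omega d), (∀ i < n, x i = y i) →
      |(transfer A)^[m] f x - (transfer A)^[m] f y| ≤ H * θ ^ n := by
  obtain ⟨C, θ₁, hC, h01, h11, h1⟩ := hA.exists_nonneg
  obtain ⟨H₂, θ₂, hH₂, h02, h12, h2⟩ := hf.exists_nonneg
  obtain ⟨M, hM, hfM⟩ := hf.exists_bound
  set θ := max θ₁ θ₂
  have hθ0 : 0 < θ := lt_max_of_lt_left h01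
  have hθ1 : θ < 1 := max_lt h11 h12
  have hθ1' : 0 < 1 - θ := by linarith
  set H := H₂ + d * C * M / (1 - θ) with hH
  have hH0 : 0 ≤ H := by positivity
  refine ⟨H, θ, hH0, hθ0, hθ1, fun m => ?_⟩
  induction m with
  | zero =>
    intro n x y hxy
    refine (h2 n x y hxy).trans ?_
    gcongr
    · rw [hH]
      have : 0 ≤ d * C * M / (1 - θ) := by positivity
      linarith
    · exact le_max_right _ _
  | succ m ih =>
    intro n x y hxy
    rw [Function.iterate_succ_apply']
    set F := (transfer A)^[m] f with hF
    have hag : ∀ a : Fin d, ∀ i < n + 1, prepend a x i = prepend a y i := by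
      intro a i hi
      rcases i with _ | i
      · rfl
      · exact hxy i (by omega)
    have e1 : ∀ a : Fin d, |Real.exp (A (prepend a x)) * F (prepend a x) -
        Real.exp (A (prepend a y)) * F (prepend a y)| ≤
        Real.exp (A (prepend a x)) * (H * θ ^ (n + 1)) + C * θ ^ (n + 1) * M := by
      intro a
      have e2 := ih (n + 1) _ _ (hag a)
      have e3 := h1 (n + 1) _ _ (hag a)
      have e4 : |Real.exp (A (prepend a x)) - Real.exp (A (prepend a y))| ≤ C * θ ^ (n + 1) := by
        refine le_trans ?_ (e3.trans (by gcongr; exact le_max_left _ _))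
        have key : ∀ u v : ℝ, u ≤ 0 → Real.exp u - Real.exp v ≤ |u - v| := by
          intro u v hu
          have q1 : Real.exp v = Real.exp u * Real.exp (v - u) := by rw [← Real.exp_add]; ring_nf
          have q2 := Real.add_one_le_exp (v - u)
          have q3 : Real.exp u ≤ 1 := Real.exp_le_one_iff.2 hu
          have q4 := Real.exp_pos u
          have q5 : Real.exp u - Real.exp v ≤ Real.exp u * (u - v) := by rw [q1]; nlinarith
          have q6 := le_abs_self (u - v)
          have q7 := abs_nonneg (u - v)
          nlinarith
        rw [abs_le']
        refine ⟨key _ _ (hN.nonpos _), ?_⟩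
        rw [neg_sub, abs_sub_comm]
        exact key _ _ (hN.nonpos _)
      calc _ = |Real.exp (A (prepend a x)) * (F (prepend a x) - F (prepend a y)) +
            (Real.exp (A (prepend a x)) - Real.exp (A (prepend a y))) * F (prepend a y)| := by
              ring_nf
        _ ≤ _ := by
          refine (abs_add_le _ _).trans ?_
          rw [abs_mul, abs_mul, abs_of_pos (Real.exp_pos _)]
          gcongr
          exact hN.abs_iterate_le hfM m _
    calc |transfer A F x - transfer A F y|
        ≤ ∑ a : Fin d, |Real.exp (A (prepend a x)) * F (prepend a x) -
            Real.exp (A (prepend a y)) * F (prepend a y)| := by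
          rw [transfer, transfer, ← Finset.sum_sub_distrib]
          exact Finset.abs_sum_le_sum_abs _ _
      _ ≤ ∑ a : Fin d, (Real.exp (A (prepend a x)) * (H * θ ^ (n + 1)) + C * θ ^ (n + 1) * M) :=
          Finset.sum_le_sum fun a _ => e1 a
      _ = (H * θ + d * C * M * θ) * θ ^ n := by
          rw [Finset.sum_add_distrib, ← Finset.sum_mul, hN.sum_exp]
          simp
          ring
      _ ≤ H * θ ^ n := by
          gcongr
          have e5 : d * C * M = (H - H₂) * (1 - θ) := by rw [hH]; field_simp; ring
          have e6 : d * C * M * θ ≤ d * C * M := mul_le_of_le_one_right (by positivity) hθ1.le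
          nlinarith

/-- The Doeblin estimate. -/
theorem IsNormalized.doeblin {A F : Omega d → ℝ} (hN : IsNormalized A) {D : ℝ}
    (hD : ∀ (n : ℕ) (x y : Omega d), (∀ i < n, x i = y i) →
      |birkhoffSum shift A n x - birkhoffSum shift A n y| ≤ D) {N : ℕ} {η R : ℝ}
    (hF : ∀ x y : Omega d, (∀ i < N, x i = y i) → |F x - F y| ≤ η)
    (hR : ∀ x y, F x - F y ≤ R) (x y : Omega d) :
    (transfer A)^[N] F x - (transfer A)^[N] F y ≤ η + (1 - Real.exp (-D)) * R := by
  rw [transfer_iterate, transfer_iterate]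
  set a : (Fin N → Fin d) → ℝ := fun w => Real.exp (birkhoffSum shift A N (cat w x)) with ha
  set b : (Fin N → Fin d) → ℝ := fun w => Real.exp (birkhoffSum shift A N (cat w y)) with hb
  have ha1 : ∑ w, a w = 1 := hN.sum_exp_birkhoffSum N x
  have hb1 : ∑ w, b w = 1 := hN.sum_exp_birkhoffSum N y
  set δ := Real.exp (-D) with hδ
  have hδ1 : δ ≤ 1 := by
    rw [hδ, Real.exp_le_one_iff, neg_nonpos]
    simpa using hD 0 x x (by simp)
  -- By distortion the weights at x dominate δ times those at y. This common part cancels, and only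
  -- mass 1 - δ sees the oscillation of `F`.
  have hab : ∀ w, δ * b w ≤ a w := fun w => by
    rw [hδ, ha, hb, ← Real.exp_add, Real.exp_le_exp]
    linarith [(abs_le.1 (hD N _ _ (cat_agree w x y))).1]
  have hne : Nonempty (Fin N → Fin d) := ⟨word N x⟩
  obtain ⟨w₀, hw₀⟩ := Finite.exists_min fun w : Fin N → Fin d => F (cat w y)
  set m := F (cat w₀ y) with hm
  have s1 : ∑ w, a w * (F (cat w x) - F (cat w y)) ≤ η := by
    calc _ ≤ ∑ w, a w * η := Finset.sum_le_sum fun w _ =>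
          mul_le_mul_of_nonneg_left ((le_abs_self _).trans (hF _ _ (cat_agree w x y)))
            (Real.exp_pos _).le
      _ = η := by rw [← Finset.sum_mul, ha1, one_mul]
  have s2 : ∑ w, (a w - δ * b w) * F (cat w y) ≤ (1 - δ) * (m + R) := by
    calc _ ≤ ∑ w, (a w - δ * b w) * (m + R) := Finset.sum_le_sum fun w _ =>
          mul_le_mul_of_nonneg_left (by linarith [hR (cat w y) (cat w₀ y)])
            (by linarith [hab w])
      _ = _ := by
        rw [← Finset.sum_mul, Finset.sum_sub_distrib, ← Finset.mul_sum, ha1, hb1, mul_one]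
  have s3 : (1 - δ) * m ≤ ∑ w, (1 - δ) * b w * F (cat w y) := by
    calc (1 - δ) * m = ∑ w, (1 - δ) * b w * m := by
          rw [← Finset.sum_mul, ← Finset.mul_sum, hb1, mul_one]
      _ ≤ _ := Finset.sum_le_sum fun w _ => mul_le_mul_of_nonneg_left (hw₀ w)
          (mul_nonneg (by linarith) (Real.exp_pos _).le)
  have s4 : ∑ w, a w * F (cat w x) - ∑ w, b w * F (cat w y) =
      ∑ w, a w * (F (cat w x) - F (cat w y)) + ∑ w, (a w - δ * b w) * F (cat w y) -
        ∑ w, (1 - δ) * b w * F (cat w y) := by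
    rw [← Finset.sum_sub_distrib, ← Finset.sum_add_distrib, ← Finset.sum_sub_distrib]
    exact Finset.sum_congr rfl fun w _ => by ring
  rw [s4]
  linarith

/-- Each block of N steps maps an oscillation bound R to Hθᴺ + (1 - δ)R, with the same `H` every
time. The fixed point Hθᴺ/δ is made small by N, the geometric remainder by the number j of blocks.
-/
theorem IsNormalized.exists_iterate_sub_le {A f : Omega d → ℝ} (hN : IsNormalized A)
    (hA : IsHolder A) (hf : IsHolder f) {ε : ℝ} (hε : 0 < ε) :
    ∃ n₀, ∀ n ≥ n₀, ∀ x y, (transfer A)^[n] f x - (transfer A)^[n] f y ≤ ε := by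
  obtain ⟨H, θ, hH, h0, h1, hu⟩ := hN.exists_uniform_holder hA hf
  obtain ⟨D, hD0, hD⟩ := hA.exists_distortion
  set δ := Real.exp (-D) with hδ
  have hδ0 : 0 < δ := Real.exp_pos _
  have hδ1 : δ ≤ 1 := Real.exp_le_one_iff.2 (by linarith)
  obtain ⟨N, hNs⟩ : ∃ N : ℕ, H * θ ^ N / δ < ε / 2 := by
    have : Tendsto (fun n : ℕ => H * θ ^ n / δ) atTop (𝓝 (H * 0 / δ)) :=
      ((tendsto_pow_atTop_nhds_zero_of_lt_one h0.le h1).const_mul H).div_const δ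
    exact (this.eventually (gt_mem_nhds (by simpa using half_pos hε))).exists
  have hosc : ∀ j : ℕ, ∀ x y, (transfer A)^[N * j] f x - (transfer A)^[N * j] f y ≤
      H * θ ^ N / δ + (1 - δ) ^ j * H := by
    intro j
    induction j with
    | zero =>
      intro x y
      have := hu 0 0 x y (by simp)
      have h2 := le_abs_self (f x - f y)
      have h3 : 0 ≤ H * θ ^ N / δ := by positivity
      simp at this ⊢
      linarith
    | succ j ih =>
      intro x y
      rw [Nat.mul_succ, add_comm, Function.iterate_add_apply]
      refine (hN.doeblin hD (fun x y hxy => hu (N * j) N x y hxy) ih x y).trans (le_of_eq ?_)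
      rw [pow_succ, ← hδ]
      field_simp
      ring
  obtain ⟨j, hj⟩ : ∃ j : ℕ, (1 - δ) ^ j * H < ε / 2 := by
    have : Tendsto (fun n : ℕ => (1 - δ) ^ n * H) atTop (𝓝 (0 * H)) :=
      (tendsto_pow_atTop_nhds_zero_of_lt_one (by linarith) (by linarith)).mul_const H
    exact (this.eventually (gt_mem_nhds (by simpa using half_pos hε))).exists
  refine ⟨N * j, fun n hn x y => ?_⟩
  obtain ⟨k, rfl⟩ := Nat.exists_eq_add_of_le hn
  rw [add_comm, Function.iterate_add_apply]
  exact hN.iterate_sub_le (fun x y => (hosc j x y).trans (by linarith)) k x y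

/-! ### The measures fixed by the dual transfer operator -/

/-- `ν` is a probability measure fixed by the dual of the transfer operator of `A`. -/
structure IsGMeasure (A : Omega d → ℝ) (ν : Measure (Omega d)) : Prop where
  prob : IsProbabilityMeasure ν
  integral_transfer : ∀ f, IsHolder f → ∫ x, transfer A f x ∂ν = ∫ x, f x ∂ν

/-- Any limit point of the dual iterates of a Dirac mass works, by compactness. No averaging is
needed: the oscillation of Lⁿf vanishes, so Lⁿ⁺¹f(x₀) - Lⁿf(x₀) tends to 0. -/
theorem exists_isGMeasure [NeZero d] {A : Omega d → ℝ} (hN : IsNormalized A) (hA : IsHolder A) :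
    ∃ ν, IsGMeasure A ν := by
  let x₀ : Omega d := fun _ => 0
  let m : ℕ → Measure (Omega d) := fun n => ∑ w : Fin n → Fin d,
    ENNReal.ofReal (Real.exp (birkhoffSum shift A n (cat w x₀))) • Measure.dirac (cat w x₀)
  have hm : ∀ n, IsProbabilityMeasure (m n) := fun n => ⟨by
    simp only [m, Measure.finsetSum_apply, Measure.smul_apply, measure_univ, smul_eq_mul, mul_one]
    rw [← ENNReal.ofReal_sum_of_nonneg fun w _ => (Real.exp_pos _).le, hN.sum_exp_birkhoffSum,
      ENNReal.ofReal_one]⟩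
  have hint : ∀ n (f : Omega d → ℝ), IsHolder f → ∫ x, f x ∂(m n) = (transfer A)^[n] f x₀ := by
    intro n f hf
    simp only [m]
    rw [integral_finsetSum_measure, transfer_iterate]
    · refine Finset.sum_congr rfl fun w _ => ?_
      rw [integral_smul_measure, integral_dirac, ENNReal.toReal_ofReal (Real.exp_pos _).le,
        smul_eq_mul]
    · intro w _
      exact (hf.integrable _).smul_measure ENNReal.ofReal_ne_top
  let P : ℕ → ProbabilityMeasure (Omega d) := fun n => ⟨m n, hm n⟩
  let ν : ProbabilityMeasure (Omega d) := ((hyperfilter ℕ).map P).lim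
  have hlim : Tendsto P (hyperfilter ℕ) (𝓝 ν) := Ultrafilter.le_nhds_lim _
  have hconv : ∀ f : Omega d → ℝ, IsHolder f →
      Tendsto (fun n => (transfer A)^[n] f x₀) (hyperfilter ℕ) (𝓝 (∫ x, f x ∂(ν : Measure _))) := by
    intro f hf
    have := ProbabilityMeasure.tendsto_iff_forall_integral_tendsto.1 hlim
      (BoundedContinuousFunction.mkOfCompact ⟨f, hf.continuous⟩)
    refine this.congr fun n => ?_
    exact hint n f hf
  refine ⟨ν, inferInstance, fun f hf => ?_⟩
  have h1 := hconv _ (hA.transfer hf)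
  have h2 := hconv _ hf
  have h3 : Tendsto (fun n => (transfer A)^[n] (transfer A f) x₀ - (transfer A)^[n] f x₀)
      atTop (𝓝 0) := by
    rw [Metric.tendsto_atTop]
    intro ε hε
    obtain ⟨n₀, hn₀⟩ := hN.exists_iterate_sub_le hA hf (half_pos hε)
    refine ⟨n₀, fun n hn => ?_⟩
    rw [← Function.iterate_succ_apply, Function.iterate_succ_apply', Real.dist_eq, sub_zero]
    have e1 := hN.transfer_le (f := (transfer A)^[n] f) (c := (transfer A)^[n] f x₀ + ε / 2)
      (fun x => by linarith [hn₀ n hn x x₀]) x₀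
    have e2 := hN.le_transfer (f := (transfer A)^[n] f) (c := (transfer A)^[n] f x₀ - ε / 2)
      (fun x => by linarith [hn₀ n hn x₀ x]) x₀
    rw [abs_lt]
    constructor <;> linarith
  have h4 := tendsto_nhds_unique (h1.sub h2) (h3.mono_left Nat.hyperfilter_le_atTop)
  linarith

/-- Indicators of cylinders are Hölder, and finite-dimensional marginals determine the measure. -/
theorem measure_ext_of_isHolder {μ ν : Measure (Omega d)} [IsProbabilityMeasure μ]
    [IsProbabilityMeasure ν] (h : ∀ f : Omega d → ℝ, IsHolder f → ∫ x, f x ∂μ = ∫ x, f x ∂ν) :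
    μ = ν := by
  refine IsProjectiveLimit.unique (P := fun I => ν.map I.restrict) (fun I => ?_) fun I => rfl
  have hI : Measurable (I.restrict : Omega d → _) := Finset.measurable_restrict I
  refine Measure.ext_of_singleton fun w => ?_
  have hs : MeasurableSet {w} := measurableSet_singleton w
  rw [Measure.map_apply hI hs, Measure.map_apply hI hs]
  have hs' := hI hs
  set S := (I.restrict : Omega d → _) ⁻¹' {w} with hS
  have hS' : ∀ x, x ∈ S ↔ I.restrict x = w := fun x => Iff.rfl
  have := h (S.indicator fun _ => 1) ?_
  · rw [integral_indicator_const _ hs', integral_indicator_const _ hs'] at this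
    simp only [smul_eq_mul, mul_one, measureReal_def] at this
    exact (ENNReal.toReal_eq_toReal_iff' (measure_ne_top _ _) (measure_ne_top _ _)).1 this
  · refine isHolder_of_eq_of_agree (n := I.sup id + 1) (M := 1) (fun x => ?_) fun x y hxy => ?_
    · by_cases hx : x ∈ S <;> simp [hx]
    · have : I.restrict x = I.restrict y := by
        funext i
        exact hxy i (Nat.lt_succ_of_le (Finset.le_sup (f := id) i.2))
      simp only [Set.indicator, hS', this]

section GMeasure

variable {A : Omega d → ℝ} {ν : Measure (Omega d)}

theorem IsGMeasure.integral_iterate (hν : IsGMeasure A ν) (hA : IsHolder A) {f : Omega d → ℝ}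
    (hf : IsHolder f) (n : ℕ) : ∫ x, (transfer A)^[n] f x ∂ν = ∫ x, f x ∂ν := by
  induction n with
  | zero => rfl
  | succ n ih =>
    rw [← ih]
    simp only [Function.iterate_succ_apply']
    exact hν.integral_transfer _ (hA.transfer_iterate hf n)

theorem IsNormalized.transfer_comp_shift (hN : IsNormalized A) (f : Omega d → ℝ) (x : Omega d) :
    transfer A (fun y => f (shift y)) x = f x := by
  simp only [transfer, shift_prepend]
  rw [← Finset.sum_mul, hN.sum_exp, one_mul]

/-- Integrate the identity L(f ∘ σ) = f. -/
theorem IsGMeasure.isInvariantProb (hν : IsGMeasure A ν) (hN : IsNormalized A) :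
    IsInvariantProb ν := by
  have := hν.prob
  refine ⟨hν.prob, continuous_shift.measurable, ?_⟩
  have : IsProbabilityMeasure (ν.map shift) :=
    Measure.isProbabilityMeasure_map continuous_shift.measurable.aemeasurable
  refine measure_ext_of_isHolder fun f hf => ?_
  rw [integral_map continuous_shift.measurable.aemeasurable
    hf.continuous.measurable.aestronglyMeasurable, ← hν.integral_transfer _ hf.comp_shift]
  simp only [hN.transfer_comp_shift]

theorem IsGMeasure.abs_iterate_sub_integral_le (hν : IsGMeasure A ν) (hA : IsHolder A)
    {f : Omega d → ℝ} (hf : IsHolder f) {n : ℕ} {ε : ℝ}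
    (h : ∀ x y, (transfer A)^[n] f x - (transfer A)^[n] f y ≤ ε) (x : Omega d) :
    |(transfer A)^[n] f x - ∫ y, f y ∂ν| ≤ ε := by
  have := hν.prob
  have hi := (hA.transfer_iterate hf n).integrable ν
  rw [← hν.integral_iterate hA hf n]
  have e1 : ∫ y, (transfer A)^[n] f y ∂ν ≤ ∫ _y, ((transfer A)^[n] f x + ε) ∂ν :=
    integral_mono hi (integrable_const _) fun y => by dsimp only; linarith [h y x]
  have e2 : ∫ _y, ((transfer A)^[n] f x - ε) ∂ν ≤ ∫ y, (transfer A)^[n] f y ∂ν :=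
    integral_mono (integrable_const _) hi fun y => by dsimp only; linarith [h x y]
  simp only [integral_const, probReal_univ, one_smul] at e1 e2
  rw [abs_le]
  constructor <;> linarith

/-- In Lⁿ applied to the indicator of the cylinder, only the inverse branch `w` contributes. -/
theorem IsGMeasure.measureReal_cylinder (hν : IsGMeasure A ν) (hA : IsHolder A) {n : ℕ}
    (w : Fin n → Fin d) :
    ν.real (word n ⁻¹' {w}) = ∫ y, Real.exp (birkhoffSum shift A n (cat w y)) ∂ν := by
  classical
  have := hν.prob
  have hs : MeasurableSet (word n ⁻¹' {w} : Set (Omega d)) :=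
    measurable_word n (measurableSet_singleton w)
  have hf : IsHolder ((word n ⁻¹' {w} : Set (Omega d)).indicator fun _ => (1 : ℝ)) := by
    refine isHolder_of_eq_of_agree (n := n) (M := 1) (fun x => ?_) fun x y hxy => ?_
    · by_cases hx : x ∈ (word n ⁻¹' {w} : Set (Omega d)) <;> simp [hx]
    · have : word n x = word n y := funext fun i => hxy i i.2
      simp [Set.indicator, this]
  have := hν.integral_iterate hA hf n
  rw [integral_indicator_const _ hs] at this
  simp only [smul_eq_mul, mul_one] at this
  rw [← this]
  congr 1
  funext y
  rw [HolderGibbs.transfer_iterate, Finset.sum_eq_single w]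
  · simp
  · intro v _ hv
    simp [hv]
  · simp

theorem IsGMeasure.gibbs (hν : IsGMeasure A ν) (hA : IsHolder A) {D : ℝ}
    (hD : ∀ (n : ℕ) (x y : Omega d), (∀ i < n, x i = y i) →
      |birkhoffSum shift A n x - birkhoffSum shift A n y| ≤ D) (n : ℕ) (x : Omega d) :
    Real.exp (birkhoffSum shift A n x - D) ≤ ν.real (word n ⁻¹' {word n x}) ∧
      ν.real (word n ⁻¹' {word n x}) ≤ Real.exp (birkhoffSum shift A n x + D) := by
  have := hν.prob
  rw [hν.measureReal_cylinder hA]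
  have hc : Continuous fun y : Omega d => cat (word n x) y := by
    refine continuous_pi fun i => ?_
    unfold cat
    split_ifs
    · exact continuous_const
    · exact continuous_apply _
  have hi : Integrable (fun y => Real.exp (birkhoffSum shift A n (cat (word n x) y))) ν :=
    ((Real.continuous_exp.comp ((birkhoffSum_continuous hA.continuous n).comp
      hc)).integrable_of_hasCompactSupport (HasCompactSupport.of_compactSpace _))
  have hb := fun y => abs_le.1 (hD n (cat (word n x) y) x fun i hi => cat_word_apply x y hi)
  constructor
  · calc _ = ∫ _y, Real.exp (birkhoffSum shift A n x - D) ∂ν := by simp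
      _ ≤ _ := integral_mono (integrable_const _) hi fun y =>
        Real.exp_le_exp.2 (by linarith [(hb y).1])
  · calc _ ≤ ∫ _y, Real.exp (birkhoffSum shift A n x + D) ∂ν :=
        integral_mono hi (integrable_const _) fun y => Real.exp_le_exp.2 (by linarith [(hb y).2])
      _ = _ := by simp

/-- By the upper Gibbs bound, the information of the n-cylinder at x is at least -Sₙ A(x) - D.
Integrating and dividing by n bounds the entropy of the partition by the zeroth letter from below.
-/
theorem IsGMeasure.neg_integral_le_entropy [NeZero d] (hν : IsGMeasure A ν) (hN : IsNormalized A)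
    (hA : IsHolder A) : -∫ x, A x ∂ν ≤ entropy ν := by
  have := hν.prob
  have hinv := hν.isInvariantProb hN
  have hf : Measurable fun x : Omega d => x 0 := measurable_pi_apply 0
  refine le_trans ?_ (partitionEntropy_le_entropy hinv hf)
  obtain ⟨D, -, hD⟩ := hA.exists_distortion
  have hjoin : ∀ n : ℕ, -D - n * ∫ x, A x ∂ν ≤ joinEntropy ν (fun x => x 0) n := by
    intro n
    obtain ⟨hi, he⟩ := integral_birkhoffSum hinv (hA.integrable ν) n
    have hw : itinerary (fun x : Omega d => x 0) n = word n := by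
      funext x i
      simp [itinerary, word, shift_iterate_apply]
    rw [joinEntropy_eq, hw, ← he]
    have : ∑ w : Fin n → Fin d, Real.negMulLog (ν.real (word n ⁻¹' {w})) =
        ∫ x, -Real.log (ν.real (word n ⁻¹' {word n x})) ∂ν := by
      rw [integral_comp_eq_sum ν (measurable_word n) fun w => -Real.log (ν.real (word n ⁻¹' {w}))]
      exact Finset.sum_congr rfl fun w _ => by rw [Real.negMulLog]; ring
    rw [this]
    calc -D - ∫ x, birkhoffSum shift A n x ∂ν = ∫ x, (-D - birkhoffSum shift A n x) ∂ν := by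
          rw [integral_sub (integrable_const _) hi]; simp
      _ ≤ _ := by
        refine integral_mono ((integrable_const _).sub hi)
          ((Integrable.of_finite (f := fun w : Fin n → Fin d =>
            -Real.log (ν.real (word n ⁻¹' {w})))).comp_measurable (measurable_word n)) fun x => ?_
        obtain ⟨h1, h2⟩ := hν.gibbs hA hD n x
        have := Real.log_le_log ((Real.exp_pos _).trans_le h1) h2
        rw [Real.log_exp] at this
        dsimp only
        linarith
  have hle : ∀ᶠ n : ℕ in atTop,
      -D / n + (-∫ x, A x ∂ν) ≤ joinEntropy ν (fun x : Omega d => x 0) n / n := by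
    filter_upwards [eventually_gt_atTop 0] with n hn
    have hn' : (0 : ℝ) < n := by exact_mod_cast hn
    rw [div_add' _ _ _ hn'.ne']
    gcongr
    linarith [hjoin n]
  have hlim : Tendsto (fun n : ℕ => -D / n + (-∫ x, A x ∂ν)) atTop (𝓝 (-∫ x, A x ∂ν)) := by
    simpa using (tendsto_const_div_atTop_nhds_zero_nat (-D)).add_const (-∫ x, A x ∂ν)
  have := limsup_le_limsup hle hlim.isCoboundedUnder_le (isBoundedUnder_joinEntropy ν hf)
  rwa [hlim.limsup_eq] at this

/-! ### Cohomologous potentials and the value of the pressure -/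

theorem IsInvariantProb.integral_comp_shift {μ : Measure (Omega d)} (hμ : IsInvariantProb μ)
    {g : Omega d → ℝ} (hg : IsHolder g) : ∫ x, g (shift x) ∂μ = ∫ x, g x ∂μ := by
  have h := hμ.2.map_eq
  rw [← integral_map (φ := shift) (f := g) hμ.2.measurable.aemeasurable
    hg.continuous.measurable.aestronglyMeasurable, h]

theorem IsInvariantProb.integral_cohomologous {μ : Measure (Omega d)} (hμ : IsInvariantProb μ)
    {B B' g : Omega d → ℝ} (hB : IsHolder B) (hg : IsHolder g) {c : ℝ}
    (h : ∀ x, B' x = B x + (g x - g (shift x)) + c) : ∫ x, B' x ∂μ = ∫ x, B x ∂μ + c := by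
  have := hμ.1
  have e1 := hB.integrable μ
  have e2 := hg.integrable μ
  have e3 := hg.comp_shift.integrable μ
  have e4 : Integrable (fun x => g x - g (shift x)) μ := e2.sub e3
  have e5 : Integrable (fun x => B x + (g x - g (shift x))) μ := e1.add e4
  simp only [h]
  rw [integral_add e5 (integrable_const _), integral_add e1 e4,
    integral_sub e2 e3, hμ.integral_comp_shift hg]
  simp

theorem bddAbove_pressure_set [NeZero d] {B : Omega d → ℝ} (hB : IsHolder B) :
    BddAbove {r : ℝ | ∃ μ : Measure (Omega d), IsInvariantProb μ ∧
      r = ∫ x, B x ∂μ + entropy μ} := by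
  obtain ⟨M, hM0, hM⟩ := (hB.transfer (isHolder_const 1)).exists_bound
  refine ⟨M, ?_⟩
  rintro _ ⟨μ, hμ, rfl⟩
  exact integral_add_entropy_le hB
    (fun x => (le_abs_self _).trans ((hM x).trans (by linarith [Real.add_one_le_exp M]))) hμ

theorem le_pressure [NeZero d] {B : Omega d → ℝ} (hB : IsHolder B) {μ : Measure (Omega d)}
    (hμ : IsInvariantProb μ) : ∫ x, B x ∂μ + entropy μ ≤ pressure B :=
  le_csSup (bddAbove_pressure_set hB) ⟨μ, hμ, rfl⟩

/-- The constant potential -log d is normalized. This makes the set defining the pressure nonempty.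
-/
theorem exists_isInvariantProb [NeZero d] : ∃ μ : Measure (Omega d), IsInvariantProb μ := by
  have hd : (0 : ℝ) < d := by exact_mod_cast NeZero.pos d
  have hN : IsNormalized (fun _ : Omega d => -Real.log d) := fun x => by
    simp [transfer, Real.exp_neg, Real.exp_log hd, hd.ne']
  obtain ⟨ν, hν⟩ := exists_isGMeasure hN (isHolder_const _)
  exact ⟨ν, hν.isInvariantProb hN⟩

/-- The pressure of a potential cohomologous to `B + c` is at most
`c + log sup (transfer B 1)`. -/
theorem pressure_le [NeZero d] {B B' g : Omega d → ℝ} (hB : IsHolder B) (hg : IsHolder g)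
    {c c' : ℝ} (h : ∀ x, B' x = B x + (g x - g (shift x)) + c)
    (hc : ∀ x, transfer B (fun _ => 1) x ≤ Real.exp c') : pressure B' ≤ c + c' := by
  obtain ⟨μ, hμ⟩ := exists_isInvariantProb (d := d)
  refine csSup_le ⟨_, μ, hμ, rfl⟩ ?_
  rintro _ ⟨μ, hμ, rfl⟩
  have := hμ.1
  have h1 := integral_add_entropy_le hB hc hμ
  have h3 := hμ.integral_cohomologous hB hg h
  linarith

theorem IsGMeasure.integral_add_entropy [NeZero d] (hν : IsGMeasure A ν) (hN : IsNormalized A)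
    (hA : IsHolder A) : ∫ x, A x ∂ν + entropy ν = 0 := by
  refine le_antisymm ?_ (by linarith [hν.neg_integral_le_entropy hN hA])
  exact integral_add_entropy_le hA (fun x => by simp [hN x]) (hν.isInvariantProb hN)

theorem IsNormalized.pressure_eq [NeZero d] (hN : IsNormalized A) (hA : IsHolder A)
    {B g : Omega d → ℝ} (hg : IsHolder g) {c : ℝ}
    (h : ∀ x, B x = A x + (g x - g (shift x)) + c) : pressure B = c := by
  refine le_antisymm ?_ ?_
  · simpa using pressure_le hA hg h (c' := 0) fun x => by simp [hN x]
  · obtain ⟨ν, hν⟩ := exists_isGMeasure hN hA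
    have := hν.prob
    have hinv := hν.isInvariantProb hN
    have hB : IsHolder B := by
      have := (hA.add (hg.sub hg.comp_shift)).add (isHolder_const c)
      exact (funext h : B = _) ▸ this
    have h1 := le_pressure hB hinv
    have h2 := hν.integral_add_entropy hN hA
    have h3 := hinv.integral_cohomologous hA hg h
    linarith

end GMeasure

/-! ### Differentiability of the pressure and uniqueness of equilibrium probabilities -/

theorem pressure_cohomologous [NeZero d] {B B' g : Omega d → ℝ} (hB : IsHolder B)
    (hg : IsHolder g) {c : ℝ} (h : ∀ x, B' x = B x + (g x - g (shift x)) + c) :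
    pressure B' = pressure B + c := by
  obtain ⟨μ, hμ⟩ := exists_isInvariantProb (d := d)
  have hB' : IsHolder B' := by
    have := (hB.add (hg.sub hg.comp_shift)).add (isHolder_const c)
    exact (funext h : B' = _) ▸ this
  refine le_antisymm ?_ ?_
  · refine csSup_le ⟨_, μ, hμ, rfl⟩ ?_
    rintro _ ⟨μ, hμ, rfl⟩
    have := hμ.integral_cohomologous hB hg h
    linarith [le_pressure hB hμ]
  · rw [← le_sub_iff_add_le]
    refine csSup_le ⟨_, μ, hμ, rfl⟩ ?_
    rintro _ ⟨μ, hμ, rfl⟩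
    have := hμ.integral_cohomologous hB hg h
    linarith [le_pressure hB' hμ]

theorem transfer_finset_sum (A : Omega d → ℝ) {ι : Type*} (s : Finset ι) (f : ι → Omega d → ℝ)
    (x : Omega d) : transfer A (fun y => ∑ i ∈ s, f i y) x = ∑ i ∈ s, transfer A (f i) x := by
  simp only [transfer, Finset.mul_sum]
  exact Finset.sum_comm

section Normalized

variable {A : Omega d → ℝ} {ν : Measure (Omega d)}

/-- A martingale-coboundary decomposition: up to a coboundary, ψ = m + R, where Lm = 0 and R = Lᴺψ
is within ε of ∫ ψ dν. In L applied to 1 + sm + (sb)², which dominates exp(sm) when |s|b ≤ 1, the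
linear term vanishes, leaving a quadratic error. -/
theorem IsGMeasure.exists_pressure_le [NeZero d] (hν : IsGMeasure A ν) (hN : IsNormalized A)
    (hA : IsHolder A) {ψ : Omega d → ℝ} (hψ : IsHolder ψ) {ε : ℝ} (hε : 0 < ε) :
    ∃ b : ℝ, 0 ≤ b ∧ ∀ s : ℝ, |s| * b ≤ 1 →
      pressure (fun x => A x + s * ψ x) ≤ s * ∫ x, ψ x ∂ν + |s| * ε + (s * b) ^ 2 := by
  obtain ⟨N, hosc⟩ := hN.exists_iterate_sub_le hA hψ hε
  set c := ∫ x, ψ x ∂ν with hc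
  set R := (transfer A)^[N] ψ with hR
  have hRh : IsHolder R := hA.transfer_iterate hψ N
  have hRc : ∀ x, |R x - c| ≤ ε := hν.abs_iterate_sub_integral_le hA hψ (hosc N le_rfl)
  let g : Omega d → ℝ := fun x => ∑ k ∈ Finset.range N, (transfer A)^[k] ψ x
  have hg : IsHolder g := IsHolder.finset_sum _ fun k _ => hA.transfer_iterate hψ k
  have hLg : IsHolder (transfer A g) := hA.transfer hg
  have htel : ∀ x, g x - transfer A g x = ψ x - R x := by
    intro x
    have : transfer A g x = ∑ k ∈ Finset.range N, (transfer A)^[k + 1] ψ x := by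
      rw [transfer_finset_sum]
      simp only [Function.iterate_succ_apply']
    rw [this, ← Finset.sum_sub_distrib]
    exact Finset.sum_range_sub' (fun k => (transfer A)^[k] ψ x) N
  let m : Omega d → ℝ := fun x => g x - transfer A g (shift x)
  have hm : IsHolder m := hg.sub hLg.comp_shift
  have hLm : ∀ x, transfer A m x = 0 := by
    intro x
    have : transfer A m x = transfer A g x - transfer A (fun y => transfer A g (shift y)) x := by
      simp only [transfer, m, mul_sub, Finset.sum_sub_distrib]
    rw [this, hN.transfer_comp_shift, sub_self]
  obtain ⟨b, hb0, hb⟩ := hm.exists_bound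
  refine ⟨b, hb0, fun s hs => ?_⟩
  have hB : IsHolder fun x => A x + (s * m x + s * R x) :=
    hA.add ((hm.const_mul s).add (hRh.const_mul s))
  have := pressure_le (B' := fun x => A x + s * ψ x) (c := 0)
    (c' := s * c + |s| * ε + (s * b) ^ 2) hB (hLg.const_mul (-s)) (fun x => ?_) fun x => ?_
  · linarith
  · have := htel x
    simp only [m]
    linear_combination -s * this
  · calc transfer (fun x => A x + (s * m x + s * R x)) (fun _ => 1) x
        ≤ ∑ a : Fin d, Real.exp (A (prepend a x)) * (Real.exp (s * c + |s| * ε) *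
            (1 + s * m (prepend a x) + (s * b) ^ 2)) := by
          refine Finset.sum_le_sum fun a _ => ?_
          set z := prepend a x
          rw [mul_one, Real.exp_add]
          gcongr
          rw [add_comm, Real.exp_add]
          have hsm : |s * m z| ≤ |s| * b := by
            rw [abs_mul]
            gcongr
            exact hb z
          have e1 := (abs_le.1 (Real.abs_exp_sub_one_sub_id_le (hsm.trans hs))).2
          have e2 : (s * m z) ^ 2 ≤ (s * b) ^ 2 := by
            rw [sq_le_sq, abs_mul s b, abs_of_nonneg hb0]
            exact hsm
          gcongr
          · have : s * (R z - c) ≤ |s| * ε := by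
              calc _ ≤ |s * (R z - c)| := le_abs_self _
                _ ≤ _ := by rw [abs_mul]; gcongr; exact hRc z
            linarith
          · linarith
      _ = Real.exp (s * c + |s| * ε) * ((1 + (s * b) ^ 2) *
            ∑ a : Fin d, Real.exp (A (prepend a x)) + s * transfer A m x) := by
          simp only [transfer, Finset.mul_sum, ← Finset.sum_add_distrib]
          exact Finset.sum_congr rfl fun a _ => by ring
      _ = Real.exp (s * c + |s| * ε) * ((s * b) ^ 2 + 1) := by
          rw [hLm, hN.sum_exp]; ring
      _ ≤ Real.exp (s * c + |s| * ε + (s * b) ^ 2) := by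
          rw [Real.exp_add _ ((s * b) ^ 2)]
          gcongr
          exact Real.add_one_le_exp _

theorem IsInvariantProb.integral_add_mul {μ : Measure (Omega d)} (hμ : IsInvariantProb μ)
    (hA : IsHolder A) {ψ : Omega d → ℝ} (hψ : IsHolder ψ) (s : ℝ) :
    ∫ x, (A x + s * ψ x) ∂μ = ∫ x, A x ∂μ + s * ∫ x, ψ x ∂μ := by
  have := hμ.1
  rw [integral_add (hA.integrable μ) ((hψ.const_mul s).integrable μ), integral_const_mul]

theorem IsNormalized.pressure_eq_zero [NeZero d] (hN : IsNormalized A) (hA : IsHolder A) :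
    pressure A = 0 :=
  hN.pressure_eq hA (isHolder_const 0) fun x => by simp

/-- The measure ν itself gives the lower bound s ∫ ψ dν, for either sign of s; `exists_pressure_le`
gives the matching upper bound up to o(s). -/
theorem IsGMeasure.hasDerivAt_pressure [NeZero d] (hν : IsGMeasure A ν) (hN : IsNormalized A)
    (hA : IsHolder A) {ψ : Omega d → ℝ} (hψ : IsHolder ψ) :
    HasDerivAt (fun s : ℝ => pressure fun x => A x + s * ψ x) (∫ x, ψ x ∂ν) 0 := by
  have h0 : pressure (fun x => A x + 0 * ψ x) = 0 := by simpa using hN.pressure_eq_zero hA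
  rw [hasDerivAt_iff_isLittleO, Asymptotics.isLittleO_iff]
  intro ε hε
  obtain ⟨b, hb, hp⟩ := hν.exists_pressure_le hN hA hψ (half_pos hε)
  have hnhds : ∀ᶠ s : ℝ in 𝓝 0, |s| * b < 1 ∧ |s| * b ^ 2 < ε / 2 := by
    have h1 : Tendsto (fun s : ℝ => |s| * b) (𝓝 0) (𝓝 (|0| * b)) :=
      (by fun_prop : Continuous fun s : ℝ => |s| * b).tendsto 0
    have h2 : Tendsto (fun s : ℝ => |s| * b ^ 2) (𝓝 0) (𝓝 (|0| * b ^ 2)) :=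
      (by fun_prop : Continuous fun s : ℝ => |s| * b ^ 2).tendsto 0
    exact (h1.eventually (gt_mem_nhds (by simp))).and
      (h2.eventually (gt_mem_nhds (by simpa using half_pos hε)))
  filter_upwards [hnhds] with s hs
  have e1 := hp s hs.1.le
  have hinv := hν.isInvariantProb hN
  have e2 := le_pressure (hA.add (hψ.const_mul s)) hinv
  rw [hinv.integral_add_mul hA hψ] at e2
  have e3 := hν.integral_add_entropy hN hA
  rw [h0, Real.norm_eq_abs, Real.norm_eq_abs, sub_zero, sub_zero, smul_eq_mul, abs_le]
  have e4 : (s * b) ^ 2 = |s| * (|s| * b ^ 2) := by rw [mul_pow, ← sq_abs s]; ring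
  have e5 : |s| * (|s| * b ^ 2) ≤ |s| * (ε / 2) := by gcongr; exact hs.2.le
  have e6 : 0 ≤ ε * |s| := by positivity
  constructor <;> linarith

/-- For an equilibrium μ, the pressure of A + sψ minus s ∫ ψ dμ is minimal at s = 0, so its
derivative ∫ ψ dν - ∫ ψ dμ vanishes. -/
theorem IsGMeasure.eq_of_isEquilibrium [NeZero d] (hν : IsGMeasure A ν) (hN : IsNormalized A)
    (hA : IsHolder A) {μ : Measure (Omega d)} (hμ : IsEquilibrium A μ) : μ = ν := by
  have := hν.prob
  have := hμ.1.1
  refine measure_ext_of_isHolder fun ψ hψ => ?_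
  have h1 := (hν.hasDerivAt_pressure hN hA hψ).sub ((hasDerivAt_id (0 : ℝ)).mul_const (∫ x, ψ x ∂μ))
  have h2 : IsLocalMin ((fun s : ℝ => pressure fun x => A x + s * ψ x) -
      fun s => id s * ∫ x, ψ x ∂μ) 0 := by
    refine Eventually.of_forall fun s => ?_
    have e1 := le_pressure (hA.add (hψ.const_mul s)) hμ.1
    rw [hμ.1.integral_add_mul hA hψ] at e1
    have e2 := hμ.2
    simp only [Pi.sub_apply, id, zero_mul, add_zero, sub_zero]
    linarith
  have h3 := h2.hasDerivAt_eq_zero h1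
  linarith

end Normalized

/-! ### Ruelle's theorem: every Hölder potential is cohomologous to a normalized one -/

/-- The nonlinear transfer operator `f ↦ log (transfer A (exp f))`. -/
def logTransfer (A f : Omega d → ℝ) (x : Omega d) : ℝ :=
  Real.log (∑ a : Fin d, Real.exp (A (prepend a x) + f (prepend a x)))

theorem sum_exp_pos [NeZero d] (u : Fin d → ℝ) : 0 < ∑ a, Real.exp (u a) :=
  Finset.sum_pos (fun _ _ => Real.exp_pos _) Finset.univ_nonempty

theorem log_sum_exp_le [NeZero d] {u v : Fin d → ℝ} {r : ℝ} (h : ∀ a, u a ≤ v a + r) :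
    Real.log (∑ a, Real.exp (u a)) ≤ Real.log (∑ a, Real.exp (v a)) + r := by
  rw [Real.log_le_iff_le_exp (sum_exp_pos u), Real.exp_add, Real.exp_log (sum_exp_pos v),
    Finset.sum_mul]
  exact Finset.sum_le_sum fun a _ => by rw [← Real.exp_add]; exact Real.exp_le_exp.2 (h a)

theorem abs_logTransfer_sub_le [NeZero d] (A : Omega d → ℝ) {f g : Omega d → ℝ} {r : ℝ}
    (h : ∀ x, |f x - g x| ≤ r) (x : Omega d) : |logTransfer A f x - logTransfer A g x| ≤ r := by
  rw [abs_sub_le_iff]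
  constructor
  · have := log_sum_exp_le (u := fun a => A (prepend a x) + f (prepend a x))
      (v := fun a => A (prepend a x) + g (prepend a x)) (r := r)
      fun a => by linarith [(abs_sub_le_iff.1 (h (prepend a x))).1]
    unfold logTransfer
    linarith
  · have := log_sum_exp_le (u := fun a => A (prepend a x) + g (prepend a x))
      (v := fun a => A (prepend a x) + f (prepend a x)) (r := r)
      fun a => by linarith [(abs_sub_le_iff.1 (h (prepend a x))).2]
    unfold logTransfer
    linarith

theorem logTransfer_holder [NeZero d] {A f : Omega d → ℝ} {C K θ : ℝ}
    (hA : ∀ (n : ℕ) (x y : Omega d), (∀ i < n, x i = y i) → |A x - A y| ≤ C * θ ^ n)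
    (hf : ∀ (n : ℕ) (x y : Omega d), (∀ i < n, x i = y i) → |f x - f y| ≤ K * θ ^ n)
    (n : ℕ) (x y : Omega d) (hxy : ∀ i < n, x i = y i) :
    |logTransfer A f x - logTransfer A f y| ≤ (C + K) * θ * θ ^ n := by
  have key : ∀ x y : Omega d, (∀ i < n, x i = y i) →
      logTransfer A f x ≤ logTransfer A f y + (C + K) * θ * θ ^ n := by
    intro x y hxy
    refine log_sum_exp_le fun a => ?_
    have hag : ∀ i < n + 1, prepend a x i = prepend a y i := by
      intro i hi
      rcases i with _ | i
      · rfl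
      · exact hxy i (by omega)
    have e1 := (abs_sub_le_iff.1 (hA _ _ _ hag)).1
    have e2 := (abs_sub_le_iff.1 (hf _ _ _ hag)).1
    rw [pow_succ] at e1 e2
    linarith
  rw [abs_sub_le_iff]
  constructor
  · linarith [key x y hxy]
  · linarith [key y x fun i hi => (hxy i hi).symm]

theorem tendsto_logTransfer [NeZero d] (A : Omega d → ℝ) {ι : Type*} {l : Filter ι}
    {F : ι → Omega d → ℝ} {f : Omega d → ℝ} (h : ∀ x, Tendsto (fun i => F i x) l (𝓝 (f x)))
    (x : Omega d) : Tendsto (fun i => logTransfer A (F i) x) l (𝓝 (logTransfer A f x)) := by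
  unfold logTransfer
  refine Tendsto.log (tendsto_finsetSum _ fun a _ => ?_) (sum_exp_pos _).ne'
  exact (Real.continuous_exp.tendsto _).comp ((h _).const_add _)

/-- `logTransfer` is nonexpansive in the sup norm, so discounting makes it a contraction and Picard
iteration from 0 converges. The bounds `K` and `M` do not depend on δ, which permits δ → 0 later. -/
theorem exists_discounted_fixedPoint [NeZero d] {A : Omega d → ℝ} {C K M θ δ : ℝ}
    (hθ0 : 0 < θ) (hA : ∀ (n : ℕ) (x y : Omega d), (∀ i < n, x i = y i) → |A x - A y| ≤ C * θ ^ n)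
    (hK0 : 0 ≤ K) (hK : (C + K) * θ ≤ K) (hM : ∀ x, |logTransfer A (fun _ => 0) x| ≤ M)
    (hδ0 : 0 < δ) (hδ1 : δ < 1) :
    ∃ f : Omega d → ℝ, (∀ x, logTransfer A (fun y => (1 - δ) * f y) x = f x) ∧
      (∀ x, |δ * f x| ≤ M) ∧
      ∀ (n : ℕ) (x y : Omega d), (∀ i < n, x i = y i) → |f x - f y| ≤ K * θ ^ n := by
  let T : (Omega d → ℝ) → Omega d → ℝ := fun f => logTransfer A fun y => (1 - δ) * f y
  let F : ℕ → Omega d → ℝ := fun k => T^[k] fun _ => 0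
  have hFs : ∀ k x, F (k + 1) x = logTransfer A (fun y => (1 - δ) * F k y) x := fun k x => by
    simp only [F, Function.iterate_succ_apply', T]
  have hM0 : 0 ≤ M := (abs_nonneg _).trans (hM fun _ => 0)
  have hstep : ∀ k x, |F (k + 1) x - F k x| ≤ M * (1 - δ) ^ k := by
    intro k
    induction k with
    | zero => intro x; simpa [F, T] using hM x
    | succ k ih =>
      intro x
      rw [hFs, hFs k]
      refine abs_logTransfer_sub_le A (fun x => ?_) x
      rw [← mul_sub, abs_mul, abs_of_pos (by linarith : 0 < 1 - δ), pow_succ']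
      calc _ ≤ (1 - δ) * (M * (1 - δ) ^ k) := by
            gcongr
            exact ih x
        _ = _ := by ring
  have hbd : ∀ k x, |δ * F k x| ≤ M := by
    intro k
    induction k with
    | zero => intro x; simpa [F] using hM0
    | succ k ih =>
      intro x
      have h1 : |logTransfer A (fun y => (1 - δ) * F k y) x - logTransfer A (fun _ => 0) x| ≤
          (1 - δ) * (M / δ) := by
        refine abs_logTransfer_sub_le A (fun x => ?_) x
        rw [sub_zero, abs_mul, abs_of_pos (by linarith : 0 < 1 - δ)]
        gcongr
        have := ih x
        rw [abs_mul, abs_of_pos hδ0] at this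
        rwa [le_div_iff₀ hδ0, mul_comm]
      rw [hFs, abs_mul, abs_of_pos hδ0, mul_comm, ← le_div_iff₀ hδ0]
      have h2 := hM x
      have h3 := abs_sub_abs_le_abs_sub (logTransfer A (fun y => (1 - δ) * F k y) x)
        (logTransfer A (fun _ => 0) x)
      have h4 : M + (1 - δ) * (M / δ) = M / δ := by field_simp; ring
      linarith
  have hhol : ∀ k n, ∀ x y : Omega d, (∀ i < n, x i = y i) → |F k x - F k y| ≤ K * θ ^ n := by
    intro k
    induction k with
    | zero => intro n x y _; simp only [F, Function.iterate_zero, id, sub_self, abs_zero]; positivity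
    | succ k ih =>
      intro n x y hxy
      rw [hFs, hFs]
      refine (logTransfer_holder hA (K := K) (fun n x y hxy => ?_) n x y hxy).trans (by gcongr)
      rw [← mul_sub, abs_mul, abs_of_pos (by linarith : 0 < 1 - δ)]
      exact (mul_le_of_le_one_left (abs_nonneg _) (by linarith)).trans (ih n x y hxy)
  have hcau : ∀ x, ∃ y, Tendsto (fun k => F k x) atTop (𝓝 y) := fun x =>
    cauchySeq_tendsto_of_complete (cauchySeq_of_le_geometric (1 - δ) M (by linarith) fun k => by
      rw [dist_comm, Real.dist_eq]
      exact hstep k x)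
  choose f hf using hcau
  refine ⟨f, fun x => ?_, fun x => ?_, fun n x y hxy => ?_⟩
  · have h1 := tendsto_logTransfer A (F := fun k y => (1 - δ) * F k y)
      (f := fun y => (1 - δ) * f y) (fun y => (hf y).const_mul _) x
    have h2 := (tendsto_add_atTop_iff_nat 1).2 (hf x)
    simp only [hFs] at h2
    exact tendsto_nhds_unique h1 h2
  · exact le_of_tendsto ((hf x).const_mul δ).abs (Eventually.of_forall fun k => hbd k x)
  · exact le_of_tendsto ((hf x).sub (hf y)).abs (Eventually.of_forall fun k => hhol k n x y hxy)

/-- Vanishing discount: fₙ - fₙ(x₀) and δₙ fₙ(x₀) are bounded and converge along an ultrafilter to g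
and c. Pointwise convergence suffices, since `logTransfer` at a point involves d values only. -/
theorem exists_logTransfer_eigenfunction [NeZero d] {A : Omega d → ℝ} (hA : IsHolder A) :
    ∃ (g : Omega d → ℝ) (c : ℝ), IsHolder g ∧ ∀ x, logTransfer A g x = g x + c := by
  obtain ⟨C, θ, hC, hθ0, hθ1, h⟩ := hA.exists_nonneg
  obtain ⟨M₀, hM₀, hAM⟩ := hA.exists_bound
  have hd : (0 : ℝ) < d := by exact_mod_cast NeZero.pos d
  have hd1 : (1 : ℝ) ≤ d := by exact_mod_cast NeZero.pos d
  have hθ1' : 0 < 1 - θ := by linarith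
  -- The solution of (C + K)θ = K, the Hölder constant preserved by `logTransfer`.
  set K := C * θ / (1 - θ) with hK
  have hK0 : 0 ≤ K := by positivity
  have hKle : (C + K) * θ ≤ K := by
    rw [hK]; apply le_of_eq; field_simp; ring
  obtain ⟨M, hM⟩ : ∃ M, ∀ x, |logTransfer A (fun _ => 0) x| ≤ M := by
    refine ⟨M₀ + Real.log d, fun x => ?_⟩
    have h1 := log_sum_exp_le (u := fun a => A (prepend a x) + 0) (v := fun _ => 0) (r := M₀)
      fun a => by linarith [(abs_le.1 (hAM (prepend a x))).2]
    have h2 := log_sum_exp_le (v := fun a => A (prepend a x) + 0) (u := fun _ => 0) (r := M₀)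
      fun a => by linarith [(abs_le.1 (hAM (prepend a x))).1]
    simp only [Real.exp_zero, Finset.sum_const, Finset.card_univ, Fintype.card_fin, nsmul_eq_mul,
      mul_one] at h1 h2
    have h3 := Real.log_nonneg hd1
    unfold logTransfer
    rw [abs_le]
    constructor <;> linarith
  have hδ : ∀ n : ℕ, (0 : ℝ) < 1 / (n + 2) ∧ (1 : ℝ) / (n + 2) < 1 := fun n =>
    ⟨by positivity, by rw [div_lt_one (by positivity)]; linarith [(Nat.cast_nonneg n : (0:ℝ) ≤ n)]⟩
  choose f hf hfM hfK using fun n : ℕ =>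
    exists_discounted_fixedPoint hθ0 h hK0 hKle hM (hδ n).1 (hδ n).2
  let x₀ : Omega d := fun _ => 0
  have hlim : ∀ (u : ℕ → ℝ) (R : ℝ), (∀ n, |u n| ≤ R) →
      ∃ y, Tendsto u (hyperfilter ℕ) (𝓝 y) := by
    intro u R hu
    obtain ⟨y, -, hy⟩ := (isCompact_Icc (a := -R) (b := R)).ultrafilter_le_nhds
      ((hyperfilter ℕ).map u) (by
        rw [le_principal_iff]
        exact Eventually.of_forall (f := (hyperfilter ℕ : Filter ℕ)) fun n => abs_le.1 (hu n))
    exact ⟨y, hy⟩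
  choose g hg using fun x => hlim (fun n => f n x - f n x₀) K fun n => by
    simpa using hfK n 0 x x₀ (by simp)
  obtain ⟨c, hc⟩ := hlim (fun n => 1 / ((n : ℝ) + 2) * f n x₀) M fun n => hfM n x₀
  refine ⟨g, c, ⟨K, θ, hθ0, hθ1, fun n x y hxy => ?_⟩, fun x => ?_⟩
  · refine le_of_tendsto ((hg x).sub (hg y)).abs (Eventually.of_forall fun k => ?_)
    rw [sub_sub_sub_cancel_right]
    exact hfK k n x y hxy
  · have hδ0 : Tendsto (fun n : ℕ => 1 - 1 / ((n : ℝ) + 2)) (hyperfilter ℕ) (𝓝 1) := by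
      have : Tendsto (fun n : ℕ => 1 - 1 / ((n : ℝ) + 2)) atTop (𝓝 (1 - 0)) := by
        refine Tendsto.const_sub _ ?_
        have := (tendsto_add_atTop_iff_nat 2).2
          (tendsto_one_div_atTop_nhds_zero_nat (𝕜 := ℝ))
        simpa using this
      rw [sub_zero] at this
      exact this.mono_left Nat.hyperfilter_le_atTop
    have h1 := tendsto_logTransfer A (l := (hyperfilter ℕ : Filter ℕ))
      (F := fun n y => (1 - 1 / ((n : ℝ) + 2)) * (f n y - f n x₀)) (f := g)
      (fun y => by simpa using hδ0.mul (hg y)) x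
    have h2 := (hg x).add hc
    refine tendsto_nhds_unique h1 (h2.congr fun n => ?_)
    have e1 := hf n x
    -- `logTransfer` commutes with adding constants; what is left over is δₙ fₙ(x₀), whose limit is
    -- c.
    have e2 : logTransfer A (fun y => (1 - 1 / ((n : ℝ) + 2)) * (f n y - f n x₀)) x =
        logTransfer A (fun y => (1 - 1 / ((n : ℝ) + 2)) * f n y) x -
          (1 - 1 / ((n : ℝ) + 2)) * f n x₀ := by
      have e3 : ∀ y, A y + (1 - 1 / ((n : ℝ) + 2)) * (f n y - f n x₀) =
        A y + (1 - 1 / ((n : ℝ) + 2)) * f n y - (1 - 1 / ((n : ℝ) + 2)) * f n x₀ := fun y => by ring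
      unfold logTransfer
      simp only [e3, Real.exp_sub]
      rw [← Finset.sum_div, Real.log_div (sum_exp_pos _).ne' (Real.exp_pos _).ne', Real.log_exp]
    rw [e2, e1]
    ring

theorem IsHolder.exists_normalized [NeZero d] {A : Omega d → ℝ} (hA : IsHolder A) :
    ∃ (B g : Omega d → ℝ) (c : ℝ), IsNormalized B ∧ IsHolder B ∧ IsHolder g ∧
      ∀ x, A x = B x + (g x - g (shift x)) + c := by
  obtain ⟨g, c, hg, h⟩ := exists_logTransfer_eigenfunction hA
  refine ⟨fun x => A x + (g x - g (shift x)) - c, fun x => -g x, c, fun x => ?_,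
    (hA.add (hg.sub hg.comp_shift)).sub (isHolder_const c), hg.neg, fun x => by ring⟩
  have h1 := h x
  have h2 : Real.exp (logTransfer A g x) = _ := Real.exp_log (sum_exp_pos _)
  rw [h1] at h2
  have h3 : HolderGibbs.transfer (fun x => A x + (g x - g (shift x)) - c) (fun _ => 1) x =
      (∑ a : Fin d, Real.exp (A (prepend a x) + g (prepend a x))) / Real.exp (g x + c) := by
    simp only [HolderGibbs.transfer, shift_prepend, mul_one]
    rw [Finset.sum_div]
    refine Finset.sum_congr rfl fun a _ => ?_
    rw [← Real.exp_sub]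
    ring_nf
  rw [h3, h2, div_self (sum_exp_pos _).ne']

/-! ### Deviation estimates -/

/-- The pressure of the potentials `t φ + A`. -/
def linePressure (φ A : Omega d → ℝ) (t : ℝ) : ℝ := pressure fun x => t * φ x + A x

/-- With `B` the normalization of tφ + A, the potential rφ + A is cohomologous to B + (r - t)φ +
P(t). Differentiation at t is thus differentiation at a normalized potential. -/
theorem exists_linePressure_data [NeZero d] {φ A : Omega d → ℝ} (hφ : IsHolder φ)
    (hA : IsHolder A) (t : ℝ) :
    ∃ (B g : Omega d → ℝ) (ν : Measure (Omega d)), IsNormalized B ∧ IsHolder B ∧ IsHolder g ∧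
      IsGMeasure B ν ∧ (∀ x, t * φ x + A x = B x + (g x - g (shift x)) + linePressure φ A t) ∧
      HasDerivAt (linePressure φ A) (∫ x, φ x ∂ν) t := by
  have hAt : IsHolder fun x => t * φ x + A x := (hφ.const_mul t).add hA
  obtain ⟨B, g, c, hN, hB, hg, h⟩ := hAt.exists_normalized
  obtain ⟨ν, hν⟩ := exists_isGMeasure hN hB
  have hc : linePressure φ A t = c := hN.pressure_eq hB hg h
  refine ⟨B, g, ν, hN, hB, hg, hν, hc ▸ h, ?_⟩
  have h1 : linePressure φ A = fun r => pressure (fun x => B x + (r - t) * φ x) + c := by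
    funext r
    refine pressure_cohomologous (hB.add (hφ.const_mul (r - t))) hg fun x => ?_
    linear_combination h x
  rw [h1]
  refine HasDerivAt.add_const c ?_
  have h2 := hν.hasDerivAt_pressure hN hB hφ
  rw [← sub_self t] at h2
  exact h2.comp_sub_const t t

theorem differentiable_linePressure [NeZero d] {φ A : Omega d → ℝ} (hφ : IsHolder φ)
    (hA : IsHolder A) : Differentiable ℝ (linePressure φ A) := fun t => by
  obtain ⟨B, g, ν, -, -, -, -, -, h⟩ := exists_linePressure_data hφ hA t
  exact h.differentiableAt

theorem bddAbove_deriv_linePressure [NeZero d] {φ A : Omega d → ℝ} (hφ : IsHolder φ)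
    (hA : IsHolder A) : BddAbove (Set.range (deriv (linePressure φ A))) := by
  obtain ⟨M, -, hM⟩ := hφ.exists_bound
  refine ⟨M, ?_⟩
  rintro _ ⟨t, rfl⟩
  obtain ⟨B, g, ν, -, -, -, hν, -, h⟩ := exists_linePressure_data hφ hA t
  have := hν.prob
  rw [h.deriv]
  calc ∫ x, φ x ∂ν ≤ ∫ _x, M ∂ν :=
        integral_mono (hφ.integrable ν) (integrable_const _) fun x => (le_abs_self _).trans (hM x)
    _ = M := by simp

theorem birkhoffSum_cohomologous {φ A B g : Omega d → ℝ} {t c : ℝ}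
    (h : ∀ x, t * φ x + A x = B x + (g x - g (shift x)) + c) (n : ℕ) (x : Omega d) :
    t * birkhoffSum shift φ n x + birkhoffSum shift A n x =
      birkhoffSum shift B n x + (g x - g (shift^[n] x)) + n * c := by
  induction n with
  | zero => simp
  | succ n ih =>
    simp only [birkhoffSum_succ, Function.iterate_succ_apply']
    push_cast
    linear_combination ih + h (shift^[n] x)

section Deviations

variable {φ A : Omega d → ℝ} {μ : Measure (Omega d)}

theorem linePressure_zero [NeZero d] (hN : IsNormalized A) (hA : IsHolder A) :
    linePressure φ A 0 = 0 := by
  simpa [linePressure] using hN.pressure_eq_zero hA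

theorem IsGMeasure.hasDerivAt_linePressure [NeZero d] (hμ : IsGMeasure A μ) (hN : IsNormalized A)
    (hA : IsHolder A) (hφ : IsHolder φ) : HasDerivAt (linePressure φ A) (∫ x, φ x ∂μ) 0 := by
  have h : linePressure φ A = fun s => pressure fun x => A x + s * φ x := by
    funext s
    simp only [linePressure, add_comm]
  rw [h]
  exact hμ.hasDerivAt_pressure hN hA hφ

theorem IsGMeasure.mul_integral_le_linePressure [NeZero d] (hμ : IsGMeasure A μ)
    (hN : IsNormalized A) (hA : IsHolder A) (hφ : IsHolder φ) (t : ℝ) :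
    t * ∫ x, φ x ∂μ ≤ linePressure φ A t := by
  have hinv := hμ.isInvariantProb hN
  have h1 := le_pressure (hA.add (hφ.const_mul t)) hinv
  rw [hinv.integral_add_mul hA hφ] at h1
  have h2 := hμ.integral_add_entropy hN hA
  simp only [linePressure, add_comm (t * φ _)]
  linarith

/-- The exponential Chebyshev bound for Birkhoff sums. -/
theorem IsGMeasure.exists_measureReal_le [NeZero d] (hμ : IsGMeasure A μ) (hA : IsHolder A)
    (hφ : IsHolder φ) {t : ℝ} (ht : 0 ≤ t) :
    ∃ C : ℝ, ∀ (n : ℕ) (r : ℝ), μ.real {x | r ≤ birkhoffSum shift φ n x} ≤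
      Real.exp (C + n * linePressure φ A t - t * r) := by
  have := hμ.prob
  obtain ⟨B, g, -, hN, hB, hg, -, h, -⟩ := exists_linePressure_data hφ hA t
  obtain ⟨M, -, hM⟩ := hg.exists_bound
  refine ⟨2 * M, fun n r => ?_⟩
  set P := linePressure φ A t
  have hF : IsHolder fun x => Real.exp (birkhoffSum shift B n x - birkhoffSum shift A n x) :=
    ((hB.birkhoffSum n).sub (hA.birkhoffSum n)).exp
  have hE : IsHolder fun x => Real.exp (t * birkhoffSum shift φ n x) :=
    ((hφ.birkhoffSum n).const_mul t).exp
  -- Applying the n-th iterate for A turns this density into the n-th iterate for B of 1, which is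
  -- 1. It differs from exp(t Sₙφ - nP(t)) by the bounded coboundary only.
  have h1 : ∫ x, Real.exp (birkhoffSum shift B n x - birkhoffSum shift A n x) ∂μ = 1 := by
    rw [← hμ.integral_iterate hA hF n]
    have : ∀ x, (transfer A)^[n]
        (fun x => Real.exp (birkhoffSum shift B n x - birkhoffSum shift A n x)) x = 1 := fun x => by
      rw [transfer_iterate, ← hN.sum_exp_birkhoffSum n x]
      refine Finset.sum_congr rfl fun w _ => ?_
      rw [← Real.exp_add]
      ring_nf
    simp [this]
  have h2 : ∫ x, Real.exp (t * birkhoffSum shift φ n x) ∂μ ≤ Real.exp (2 * M + n * P) := by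
    calc _ ≤ ∫ x, Real.exp (2 * M + n * P) *
          Real.exp (birkhoffSum shift B n x - birkhoffSum shift A n x) ∂μ := by
          refine integral_mono (hE.integrable μ) ((hF.const_mul _).integrable μ) fun x => ?_
          dsimp only
          rw [← Real.exp_add, Real.exp_le_exp]
          have e1 := birkhoffSum_cohomologous h n x
          have e2 := (abs_le.1 (hM x)).2
          have e3 := (abs_le.1 (hM (shift^[n] x))).1
          linarith
      _ = _ := by rw [integral_const_mul, h1, mul_one]
  have h3 := mul_meas_ge_le_integral_of_nonneg (μ := μ)
    (f := fun x => Real.exp (t * birkhoffSum shift φ n x))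
    (Eventually.of_forall fun x => (Real.exp_pos _).le) (hE.integrable μ) (Real.exp (t * r))
  have h4 : μ.real {x | r ≤ birkhoffSum shift φ n x} ≤
      μ.real {x | Real.exp (t * r) ≤ Real.exp (t * birkhoffSum shift φ n x)} := by
    refine measureReal_mono (fun x hx => ?_) (measure_ne_top _ _)
    exact Real.exp_le_exp.2 (mul_le_mul_of_nonneg_left hx ht)
  rw [Real.exp_sub, le_div_iff₀ (Real.exp_pos _), mul_comm]
  exact (mul_le_mul_of_nonneg_left h4 (Real.exp_pos _).le).trans (h3.trans h2)

/-- P(0) = 0 and P'(0) = ∫ φ dμ < E, so chords over short intervals [0, t] have slope below E. -/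
theorem IsGMeasure.exists_pos_linePressure_lt [NeZero d] (hμ : IsGMeasure A μ)
    (hN : IsNormalized A) (hA : IsHolder A) (hφ : IsHolder φ) {E : ℝ} (hE : ∫ x, φ x ∂μ < E) :
    ∃ t : ℝ, 0 < t ∧ linePressure φ A t < t * E := by
  have h := (hμ.hasDerivAt_linePressure hN hA hφ).hasDerivWithinAt (s := Set.Ioi 0)
  rw [hasDerivWithinAt_iff_tendsto_slope' (by simp)] at h
  obtain ⟨t, ht, ht0⟩ := ((h.eventually (gt_mem_nhds hE)).and eventually_mem_nhdsWithin).exists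
  have ht0' : 0 < t := ht0
  refine ⟨t, ht0', ?_⟩
  rw [slope_def_field, linePressure_zero hN hA, sub_zero, sub_zero, div_lt_iff₀ ht0'] at ht
  linarith

theorem IsGMeasure.tendsto_measureReal_zero [NeZero d] (hμ : IsGMeasure A μ)
    (hN : IsNormalized A) (hA : IsHolder A) (hφ : IsHolder φ) {u : ℕ → ℝ} {E : ℝ}
    (hu : Tendsto u atTop (𝓝 E)) (hE : ∫ x, φ x ∂μ < E) :
    Tendsto (fun n : ℕ => μ.real {x | n * u n ≤ birkhoffSum shift φ n x}) atTop (𝓝 0) := by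
  obtain ⟨t, ht, hlt⟩ := hμ.exists_pos_linePressure_lt hN hA hφ hE
  obtain ⟨C, hC⟩ := hμ.exists_measureReal_le hA hφ ht.le
  refine squeeze_zero (fun n => measureReal_nonneg) (fun n => hC n _) ?_
  refine Real.tendsto_exp_atBot.comp ?_
  have h1 : Tendsto (fun n : ℕ => linePressure φ A t - t * u n) atTop
      (𝓝 (linePressure φ A t - t * E)) := (hu.const_mul t).const_sub _
  have h2 := tendsto_atBot_add_const_left _ C (tendsto_natCast_atTop_atTop.atTop_mul_neg
    (by linarith : linePressure φ A t - t * E < 0) h1)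
  refine h2.congr fun n => ?_
  ring

/-- The exponential lower bound obtained by tilting the measure. -/
theorem IsGMeasure.eventually_exp_le [NeZero d] (hμ : IsGMeasure A μ) (hA : IsHolder A)
    (hφ : IsHolder φ) {u : ℕ → ℝ} {E t : ℝ} (hu : Tendsto u atTop (𝓝 E))
    (ht : E < deriv (linePressure φ A) t) {η : ℝ} (hη : 0 < η) :
    ∀ᶠ n : ℕ in atTop,
      Real.exp (n * (linePressure φ A t - t * deriv (linePressure φ A) t - η)) ≤
        μ.real {x | n * u n < birkhoffSum shift φ n x} := by
  classical
  have := hμ.prob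
  obtain ⟨B, g, ν, hN, hB, hg, hν, h, hder⟩ := exists_linePressure_data hφ hA t
  have := hν.prob
  rw [hder.deriv] at ht ⊢
  set P := linePressure φ A t
  set E' := ∫ x, φ x ∂ν with hE'
  obtain ⟨M, -, hM⟩ := hg.exists_bound
  obtain ⟨K, -, hK⟩ := hφ.exists_distortion
  obtain ⟨D, -, hD⟩ := hA.exists_distortion
  obtain ⟨D', -, hD'⟩ := hB.exists_distortion
  obtain ⟨ρ, hρ0, hρ1, hρ2⟩ : ∃ ρ > 0, ρ < E' - E ∧ |t| * ρ < η := by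
    refine ⟨min ((E' - E) / 2) (η / (|t| + 1)), ?_, ?_, ?_⟩
    · have : 0 < E' - E := by linarith
      positivity
    · exact (min_le_left _ _).trans_lt (by linarith)
    · calc |t| * min ((E' - E) / 2) (η / (|t| + 1)) ≤ |t| * (η / (|t| + 1)) := by
            gcongr; exact min_le_right _ _
        _ < η := by rw [mul_div_assoc', div_lt_iff₀ (by positivity)]; linarith
  -- The Chebyshev bounds for φ and -φ under ν show that these sets have ν-measure at least 1/2 for
  -- large n.
  let good : ℕ → Set (Omega d) := fun n => {x | |birkhoffSum shift φ n x - n * E'| < n * ρ}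
  have hgood : ∀ᶠ n : ℕ in atTop, 1 / 2 ≤ ν.real (good n) := by
    have h1 := hν.tendsto_measureReal_zero hN hB hφ (u := fun _ => E' + ρ) tendsto_const_nhds
      (by linarith)
    have h2 := hν.tendsto_measureReal_zero hN hB hφ.neg (u := fun _ => -E' + ρ)
      tendsto_const_nhds (by rw [integral_neg]; linarith)
    filter_upwards [h1.eventually (gt_mem_nhds (by norm_num : (0 : ℝ) < 1 / 4)),
      h2.eventually (gt_mem_nhds (by norm_num : (0 : ℝ) < 1 / 4))] with n e1 e2
    have hsub : (Set.univ : Set (Omega d)) ⊆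
        good n ∪ ({x | n * (E' + ρ) ≤ birkhoffSum shift φ n x} ∪
          {x | n * (-E' + ρ) ≤ birkhoffSum shift (fun x => -φ x) n x}) := by
      intro x _
      by_cases hx : x ∈ good n
      · exact Or.inl hx
      · right
        have hx' : ¬ |birkhoffSum shift φ n x - n * E'| < n * ρ := hx
        rw [not_lt, le_abs'] at hx'
        have e : birkhoffSum shift (fun x => -φ x) n x = -birkhoffSum shift φ n x := by
          simp [birkhoffSum]
        simp only [Set.mem_union, Set.mem_ofPred_eq, e]
        rcases hx' with hx' | hx'
        · right; linarith
        · left; linarith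
    have e3 := measureReal_mono (μ := ν) hsub (measure_ne_top _ _)
    rw [probReal_univ] at e3
    have e4 := measureReal_union_le (μ := ν) (good n)
      ({x | n * (E' + ρ) ≤ birkhoffSum shift φ n x} ∪
        {x | n * (-E' + ρ) ≤ birkhoffSum shift (fun x => -φ x) n x})
    have e5 := measureReal_union_le (μ := ν) {x | n * (E' + ρ) ≤ birkhoffSum shift φ n x}
        {x | n * (-E' + ρ) ≤ birkhoffSum shift (fun x => -φ x) n x}
    linarith
  have hlarge : ∀ᶠ n : ℕ in atTop, n * u n < n * E' - n * ρ - K := by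
    have h1 : Tendsto (fun n : ℕ => E' - ρ - u n) atTop (𝓝 (E' - ρ - E)) := hu.const_sub _
    have h2 := tendsto_natCast_atTop_atTop.atTop_mul_pos (by linarith : 0 < E' - ρ - E) h1
    filter_upwards [h2.eventually (eventually_gt_atTop K)] with n hn
    linarith
  have hexp : ∀ᶠ n : ℕ in atTop, D + D' + 2 * M + Real.log 2 ≤ n * (η - |t| * ρ) := by
    have := tendsto_natCast_atTop_atTop.atTop_mul_const (by linarith : 0 < η - |t| * ρ)
    exact this.eventually (eventually_ge_atTop _)
  filter_upwards [hgood, hlarge, hexp] with n h1 h2 h3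
  -- Whole cylinders that meet `good n`: by distortion they lie in the target set, the loss K being
  -- covered by `h2`. On each, the two Gibbs bounds compare μ with ν; the factor 2 in `hcomp`
  -- offsets the mass 1/2.
  let W : Finset (Fin n → Fin d) := Finset.univ.filter fun w => ∃ x ∈ good n, word n x = w
  have hcomp : ∀ w ∈ W, Real.exp (n * (P - t * E' - η)) * 2 * ν.real (word n ⁻¹' {w}) ≤
      μ.real (word n ⁻¹' {w}) := by
    intro w hw
    obtain ⟨x, hx, rfl⟩ := (Finset.mem_filter.1 hw).2
    have g1 := (hμ.gibbs hA hD n x).1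
    have g2 := (hν.gibbs hB hD' n x).2
    have e1 := birkhoffSum_cohomologous h n x
    have e2 := (abs_le.1 (hM x)).1
    have e3 := (abs_le.1 (hM (shift^[n] x))).2
    have e4 : t * (birkhoffSum shift φ n x - n * E') ≤ |t| * (n * ρ) := by
      calc _ ≤ |t * (birkhoffSum shift φ n x - n * E')| := le_abs_self _
        _ ≤ _ := by
          rw [abs_mul]
          exact mul_le_mul_of_nonneg_left (le_of_lt hx) (abs_nonneg t)
    calc _ ≤ Real.exp (n * (P - t * E' - η)) * 2 * Real.exp (birkhoffSum shift B n x + D') := by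
          gcongr
      _ = Real.exp (n * (P - t * E' - η) + Real.log 2 + (birkhoffSum shift B n x + D')) := by
          rw [Real.exp_add _ (_ + D'), Real.exp_add _ (Real.log 2), Real.exp_log two_pos]
      _ ≤ Real.exp (birkhoffSum shift A n x - D) := Real.exp_le_exp.2 (by linarith)
      _ ≤ _ := g1
  have hmeas : ∀ w ∈ W, MeasurableSet (word n ⁻¹' {w} : Set (Omega d)) := fun w _ =>
    measurable_word n (measurableSet_singleton w)
  have hν1 : ν.real (good n) ≤ ∑ w ∈ W, ν.real (word n ⁻¹' {w}) := by
    rw [sum_measureReal_preimage_singleton W hmeas]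
    refine measureReal_mono (fun x hx => ?_) (measure_ne_top _ _)
    exact Finset.mem_coe.2 (Finset.mem_filter.2 ⟨Finset.mem_univ _, x, hx, rfl⟩)
  have hμ1 : ∑ w ∈ W, μ.real (word n ⁻¹' {w}) ≤
      μ.real {x | n * u n < birkhoffSum shift φ n x} := by
    rw [sum_measureReal_preimage_singleton W hmeas]
    refine measureReal_mono (fun y hy => ?_) (measure_ne_top _ _)
    obtain ⟨x, hx, hxy⟩ := (Finset.mem_filter.1 (Finset.mem_coe.1 hy)).2
    have e1 := (abs_le.1 (hK n x y fun i hi => congrFun hxy ⟨i, hi⟩)).2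
    have e2 := (abs_lt.1 (show |birkhoffSum shift φ n x - n * E'| < n * ρ from hx)).1
    show n * u n < birkhoffSum shift φ n y
    linarith
  calc Real.exp (n * (P - t * E' - η))
      = Real.exp (n * (P - t * E' - η)) * 2 * (1 / 2) := by ring
    _ ≤ Real.exp (n * (P - t * E' - η)) * 2 * ∑ w ∈ W, ν.real (word n ⁻¹' {w}) := by
        gcongr
        exact h1.trans hν1
    _ = ∑ w ∈ W, Real.exp (n * (P - t * E' - η)) * 2 * ν.real (word n ⁻¹' {w}) := by
        rw [Finset.mul_sum]
    _ ≤ ∑ w ∈ W, μ.real (word n ⁻¹' {w}) := Finset.sum_le_sum hcomp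
    _ ≤ _ := hμ1

theorem log_div_le_of_measureReal_le {Ω : Type*} [MeasurableSpace Ω] {μ : Measure Ω}
    [IsFiniteMeasure μ] {s : Set Ω} {y : ℝ} (h : μ.real s ≤ Real.exp y) (n : ℕ) :
    ENNReal.log (μ s) / (n : EReal) ≤ ((y / n : ℝ) : EReal) := by
  have : ENNReal.log (μ s) ≤ (y : EReal) := by
    rw [← Real.log_exp y, ← ENNReal.log_ofReal_of_pos (Real.exp_pos y)]
    exact ENNReal.log_le_log ((ENNReal.le_ofReal_iff_toReal_le (measure_ne_top _ _)
      (Real.exp_pos y).le).2 h)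
  rw [EReal.coe_div]
  exact EReal.div_le_div_right_of_nonneg (by exact_mod_cast n.cast_nonneg) this

theorem le_log_div_of_le_measureReal {Ω : Type*} [MeasurableSpace Ω] {μ : Measure Ω}
    [IsFiniteMeasure μ] {s : Set Ω} {y : ℝ} (h : Real.exp y ≤ μ.real s) (n : ℕ) :
    ((y / n : ℝ) : EReal) ≤ ENNReal.log (μ s) / (n : EReal) := by
  have : (y : EReal) ≤ ENNReal.log (μ s) := by
    rw [← Real.log_exp y, ← ENNReal.log_ofReal_of_pos (Real.exp_pos y)]
    exact ENNReal.log_le_log (ENNReal.ofReal_le_of_le_toReal h)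
  rw [EReal.coe_div]
  exact EReal.div_le_div_right_of_nonneg (by exact_mod_cast n.cast_nonneg) this

/-- The Legendre transform of the pressure at `E`. -/
def rate (φ A : Omega d → ℝ) (E : ℝ) : EReal :=
  ⨆ t : ℝ, ((t * E - linePressure φ A t : ℝ) : EReal)

theorem IsGMeasure.rate_pos [NeZero d] (hμ : IsGMeasure A μ) (hN : IsNormalized A)
    (hA : IsHolder A) (hφ : IsHolder φ) {E : ℝ} (hE : ∫ x, φ x ∂μ < E) : 0 < rate φ A E := by
  obtain ⟨t, -, ht⟩ := hμ.exists_pos_linePressure_lt hN hA hφ hE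
  refine lt_of_lt_of_le ?_ (le_iSup (fun t : ℝ => ((t * E - linePressure φ A t : ℝ) : EReal)) t)
  exact_mod_cast sub_pos.2 ht

/-- From P' ≤ b follows tE - P(t) ≥ t(E - b) for t ≥ 0, which is unbounded. -/
theorem rate_eq_top [NeZero d] (hN : IsNormalized A) (hA : IsHolder A) (hφ : IsHolder φ) {E : ℝ}
    (hE : (⨆ t, deriv (linePressure φ A) t) < E) : rate φ A E = ⊤ := by
  set b := ⨆ t, deriv (linePressure φ A) t with hb
  have hle : ∀ t, 0 ≤ t → linePressure φ A t ≤ t * b := by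
    intro t ht
    have hd := differentiable_linePressure hφ hA
    have hmono : Monotone fun t => t * b - linePressure φ A t := by
      refine monotone_of_deriv_nonneg (by fun_prop) fun t => ?_
      have : HasDerivAt (fun t => t * b - linePressure φ A t)
          (1 * b - deriv (linePressure φ A) t) t :=
        ((hasDerivAt_id t).mul_const b).sub (hd t).hasDerivAt
      rw [this.deriv, one_mul, sub_nonneg]
      exact le_ciSup (bddAbove_deriv_linePressure hφ hA) t
    have := hmono ht
    simp only [zero_mul, linePressure_zero hN hA] at this
    linarith
  rw [EReal.eq_top_iff_forall_lt]
  intro y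
  have hEb : 0 < E - b := by linarith
  set t := (|y| + 1) / (E - b) with ht
  have ht0 : 0 ≤ t := by positivity
  refine lt_of_lt_of_le ?_ (le_iSup (fun t : ℝ => ((t * E - linePressure φ A t : ℝ) : EReal)) t)
  have e1 : t * (E - b) = |y| + 1 := by rw [ht]; field_simp
  have e2 := hle t ht0
  have e3 := le_abs_self y
  exact_mod_cast (by linarith : y < t * E - linePressure φ A t)

/-- The sets `S n` are only sandwiched, so that strict and nonstrict tests are covered together. At
E = sup P' no slope exceeds E, so the tilting bound is unavailable. -/
theorem IsGMeasure.tendsto_log_div [NeZero d] (hμ : IsGMeasure A μ) (hN : IsNormalized A)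
    (hA : IsHolder A) (hφ : IsHolder φ) {u : ℕ → ℝ} {E : ℝ} (hu : Tendsto u atTop (𝓝 E))
    (hE : ∫ x, φ x ∂μ < E) (hne : E ≠ ⨆ t, deriv (linePressure φ A) t) {S : ℕ → Set (Omega d)}
    (hS1 : ∀ᶠ n : ℕ in atTop, {x | n * u n < birkhoffSum shift φ n x} ⊆ S n)
    (hS2 : ∀ᶠ n : ℕ in atTop, S n ⊆ {x | n * u n ≤ birkhoffSum shift φ n x}) :
    Tendsto (fun n : ℕ => ENNReal.log (μ (S n)) / (n : EReal)) atTop (𝓝 (-rate φ A E)) := by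
  have := hμ.prob
  have hder := hμ.hasDerivAt_linePressure hN hA hφ
  refine tendsto_order.2 ⟨fun a ha => ?_, fun a ha => ?_⟩
  · rcases hne.lt_or_gt with hlt | hlt
    · obtain ⟨t₁, ht₁⟩ := exists_lt_of_lt_ciSup hlt
      rw [EReal.lt_neg_comm] at ha
      obtain ⟨r, hr1, hr2⟩ := EReal.lt_iff_exists_real_btwn.1 ha
      obtain ⟨r', hr1', hr2'⟩ := EReal.lt_iff_exists_real_btwn.1 hr2
      have hrr : r < r' := by exact_mod_cast hr1'
      have hrate : ∀ t, t * E - linePressure φ A t < r := fun t => by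
        have := (le_iSup (fun t : ℝ => ((t * E - linePressure φ A t : ℝ) : EReal)) t).trans_lt hr1
        exact_mod_cast this
      obtain ⟨E', hE1, hE2, hE3⟩ : ∃ E', E < E' ∧ E' < deriv (linePressure φ A) t₁ ∧
          |t₁| * (E' - E) < (r' - r) / 2 := by
        have h1 : Tendsto (fun E' => |t₁| * (E' - E)) (𝓝[>] E) (𝓝 (|t₁| * (E - E))) :=
          ((by fun_prop : Continuous fun E' => |t₁| * (E' - E)).tendsto E).mono_left
            nhdsWithin_le_nhds
        rw [sub_self, mul_zero] at h1
        have h2 : ∀ᶠ E' in 𝓝[>] E, E' < deriv (linePressure φ A) t₁ :=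
          nhdsWithin_le_nhds (gt_mem_nhds ht₁)
        obtain ⟨E', h3, h4, h5⟩ := ((h1.eventually (gt_mem_nhds (by linarith :
          0 < (r' - r) / 2))).and (h2.and eventually_mem_nhdsWithin)).exists
        exact ⟨E', h5, h4, h3⟩
      -- Darboux's theorem; continuity of P' is not needed. Keeping t between 0 and t₁ bounds the
      -- cost t(E' - E) uniformly.
      obtain ⟨t, htmem, htE⟩ : E' ∈ deriv (linePressure φ A) '' Set.uIcc 0 t₁ := by
        refine (Set.ordConnected_uIcc.image_deriv fun x _ =>
          differentiable_linePressure hφ hA x).out ⟨0, Set.left_mem_uIcc, rfl⟩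
          ⟨t₁, Set.right_mem_uIcc, rfl⟩ ⟨?_, hE2.le⟩
        rw [hder.deriv]
        linarith
      have htle : |t| ≤ |t₁| := by
        have := Set.abs_sub_left_of_mem_uIcc htmem
        simpa using this
      filter_upwards [hμ.eventually_exp_le hA hφ hu (t := t) (by rw [htE]; exact hE1)
        (by linarith : 0 < (r' - r) / 2), hS1, eventually_gt_atTop 0] with n hn hSn hn0
      have hn0' : (n : ℝ) ≠ 0 := by exact_mod_cast hn0.ne'
      have h1 := le_log_div_of_le_measureReal
        (hn.trans (measureReal_mono hSn (measure_ne_top _ _))) n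
      refine lt_of_lt_of_le ?_ h1
      rw [mul_div_cancel_left₀ _ hn0', htE]
      rw [EReal.lt_neg_comm] at hr2'
      refine hr2'.trans ?_
      have e1 : t * (E' - E) ≤ |t₁| * (E' - E) := by
        gcongr
        exact (le_abs_self t).trans htle
      have e2 := hrate t
      exact_mod_cast (by linarith : -r' < linePressure φ A t - t * E' - (r' - r) / 2)
    · rw [rate_eq_top hN hA hφ hlt, EReal.neg_top] at ha
      exact absurd ha not_lt_bot
  · rw [gt_iff_lt, EReal.neg_lt_comm] at ha
    -- Chebyshev needs t ≥ 0. A negative t can be replaced by 0, because P(t) ≥ t ∫ φ dμ ≥ tE there.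
    obtain ⟨t, ht0, ht⟩ : ∃ t : ℝ, 0 ≤ t ∧ -a < ((t * E - linePressure φ A t : ℝ) : EReal) := by
      obtain ⟨t, ht⟩ := lt_iSup_iff.1 ha
      rcases le_or_gt 0 t with h0 | h0
      · exact ⟨t, h0, ht⟩
      · refine ⟨0, le_rfl, ht.trans_le ?_⟩
        have e1 := hμ.mul_integral_le_linePressure hN hA hφ t
        have e2 : t * E ≤ t * ∫ x, φ x ∂μ := mul_le_mul_of_nonpos_left hE.le h0.le
        have e3 := linePressure_zero (φ := φ) hN hA
        exact_mod_cast (by rw [e3]; linarith :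
          t * E - linePressure φ A t ≤ 0 * E - linePressure φ A 0)
    rw [EReal.neg_lt_comm] at ht
    obtain ⟨C, hC⟩ := hμ.exists_measureReal_le hA hφ ht0
    have hlim : Tendsto (fun n : ℕ => C / n + (linePressure φ A t - t * u n)) atTop
        (𝓝 (0 + (linePressure φ A t - t * E))) :=
      (tendsto_const_div_atTop_nhds_zero_nat C).add ((hu.const_mul t).const_sub _)
    have hlim' := (continuous_coe_real_ereal.tendsto _).comp hlim
    have ht' : ((0 + (linePressure φ A t - t * E) : ℝ) : EReal) < a := by
      rw [zero_add, ← neg_sub, EReal.coe_neg]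
      exact ht
    filter_upwards [hlim'.eventually (gt_mem_nhds ht'), hS2, eventually_gt_atTop 0]
      with n hn hSn hn0
    have hn0' : (n : ℝ) ≠ 0 := by exact_mod_cast hn0.ne'
    refine (log_div_le_of_measureReal_le
      ((measureReal_mono hSn (measure_ne_top _ _)).trans (hC n _)) n).trans_lt ?_
    convert hn using 1
    simp only [Function.comp]
    congr 1
    field_simp
    ring

end Deviations

/-! ### Test statistics -/

theorem IsHolderJacobian.isNormalized {J : Omega d → ℝ} (h : IsHolderJacobian J) :
    IsNormalized fun x => Real.log (J x) := fun x => by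
  simp only [transfer, Real.exp_log (h.pos _), mul_one, h.sum_eq_one]

theorem IsHolderGibbs.neZero {J : Omega d → ℝ} {μ : Measure (Omega d)} (h : IsHolderGibbs J μ) :
    NeZero d := by
  have := h.equilibrium.1.1
  obtain ⟨x⟩ := nonempty_of_isProbabilityMeasure μ
  exact ⟨(x 0).pos.ne'⟩

/-- Uniqueness passes from the variational definition to the fixed-point equation on which the
deviation estimates rest. -/
theorem IsHolderGibbs.isGMeasure {J : Omega d → ℝ} {μ : Measure (Omega d)}
    (h : IsHolderGibbs J μ) : IsGMeasure (fun x => Real.log (J x)) μ := by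
  have := h.neZero
  obtain ⟨ν, hν⟩ := exists_isGMeasure h.jacobian.isNormalized h.jacobian.holder
  rwa [hν.eq_of_isEquilibrium h.jacobian.isNormalized h.jacobian.holder h.equilibrium]

theorem testStat_eq {J₀ J₁ : Omega d → ℝ} (h₀ : ∀ x, 0 < J₀ x) (h₁ : ∀ x, 0 < J₁ x) (n : ℕ)
    (x : Omega d) : testStat J₀ J₁ n x =
      (1 / n) * birkhoffSum shift (fun x => Real.log (J₀ x) - Real.log (J₁ x)) n x := by
  simp only [testStat, birkhoffSum, Real.log_div (h₀ _).ne' (h₁ _).ne']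

theorem testStat_sub_pos_iff {J₀ J₁ : Omega d → ℝ} (h₀ : ∀ x, 0 < J₀ x) (h₁ : ∀ x, 0 < J₁ x)
    {n : ℕ} (hn : 0 < n) (u : ℝ) (x : Omega d) : testStat J₀ J₁ n x - u > 0 ↔
      n * u < birkhoffSum shift (fun x => Real.log (J₀ x) - Real.log (J₁ x)) n x := by
  have hn' : (0 : ℝ) < n := by exact_mod_cast hn
  rw [testStat_eq h₀ h₁, gt_iff_lt, sub_pos, one_div, inv_mul_eq_div, lt_div_iff₀ hn', mul_comm]

theorem birkhoffSum_swap (J₀ J₁ : Omega d → ℝ) (n : ℕ) (x : Omega d) :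
    birkhoffSum shift (fun x => Real.log (J₁ x) - Real.log (J₀ x)) n x =
      -birkhoffSum shift (fun x => Real.log (J₀ x) - Real.log (J₁ x)) n x := by
  simp [birkhoffSum]

theorem tendsto_measure_one_of_compl {Ω : Type*} [MeasurableSpace Ω] {μ : Measure Ω}
    [IsProbabilityMeasure μ] {s t : ℕ → Set Ω} (hst : ∀ᶠ n in atTop, (s n)ᶜ ⊆ t n)
    (ht : Tendsto (fun n => μ.real (t n)) atTop (𝓝 0)) :
    Tendsto (fun n => μ (s n)) atTop (𝓝 1) := by
  have h1 : Tendsto (fun n => μ (t n)) atTop (𝓝 0) :=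
    (ENNReal.tendsto_toReal_iff (fun n => measure_ne_top _ _) ENNReal.zero_ne_top).1 ht
  have h2 : Tendsto (fun n => 1 - μ (t n)) atTop (𝓝 (1 - 0)) :=
    ENNReal.Tendsto.sub tendsto_const_nhds h1 (Or.inl ENNReal.one_ne_top)
  rw [tsub_zero] at h2
  refine tendsto_of_tendsto_of_tendsto_of_le_of_le' h2 tendsto_const_nhds ?_
    (Eventually.of_forall fun n => prob_le_one)
  filter_upwards [hst] with n hn
  rw [tsub_le_iff_right, ← measure_univ (μ := μ)]
  refine (measure_mono fun x _ => ?_).trans (measure_union_le (s n) (t n))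
  by_cases hx : x ∈ s n
  · exact Or.inl hx
  · exact Or.inr (hn hx)

theorem deviation_eq_rate (J₀ J₁ : Omega d → ℝ) (E : ℝ) : deviation J₀ J₁ J₁ E 0 =
    rate (fun x => Real.log (J₀ x) - Real.log (J₁ x)) (fun x => Real.log (J₁ x)) E := by
  simp only [deviation, zero_add]
  rfl

theorem deviation_eq_rate_swap (J₀ J₁ : Omega d → ℝ) (E : ℝ) : deviation J₀ J₁ J₀ E 0 =
    rate (fun x => Real.log (J₁ x) - Real.log (J₀ x)) (fun x => Real.log (J₀ x)) (-E) := by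
  rw [rate, ← (Equiv.neg ℝ).iSup_comp]
  simp only [deviation, zero_add, Equiv.neg_apply, neg_mul_neg]
  refine iSup_congr fun t => ?_
  have : linePressure (fun x => Real.log (J₁ x) - Real.log (J₀ x)) (fun x => Real.log (J₀ x)) (-t) =
      pressureFun J₀ J₁ J₀ t := by
    unfold linePressure pressureFun
    congr 1
    funext x
    ring
  rw [this]

/-- The exchanged line of potentials is the original one traversed by 1 - t, which reverses the sign
of the slopes. -/
theorem cMinus_eq (J₀ J₁ : Omega d → ℝ) : cMinus J₀ J₁ = -⨆ t, deriv (linePressure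
    (fun x => Real.log (J₁ x) - Real.log (J₀ x)) (fun x => Real.log (J₀ x))) t := by
  have h : linePressure (fun x => Real.log (J₁ x) - Real.log (J₀ x)) (fun x => Real.log (J₀ x)) =
      fun t => pressureFun J₀ J₁ J₁ (1 - t) := by
    funext t
    unfold linePressure pressureFun
    congr 1
    funext x
    ring
  rw [h]
  simp only [deriv_comp_const_sub]
  have h2 : ⨆ t, -deriv (pressureFun J₀ J₁ J₁) (1 - t) = ⨆ t, -deriv (pressureFun J₀ J₁ J₁) t :=
    (Equiv.subLeft (1 : ℝ)).iSup_comp (g := fun t => -deriv (pressureFun J₀ J₁ J₁) t)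
  rw [h2, cMinus, iInf, iSup, Real.sInf_def]
  congr 2
  ext y
  simp [neg_eq_iff_eq_neg]

end HolderGibbs

end

theorem proposition3p1 {d : ℕ} (J₀ J₁ : HolderGibbs.Omega d → ℝ)
    (μ₀ μ₁ : Measure (HolderGibbs.Omega d))
    (h₀ : HolderGibbs.IsHolderGibbs J₀ μ₀) (h₁ : HolderGibbs.IsHolderGibbs J₁ μ₁)
    (u : ℕ → ℝ) (E : ℝ) (hu : Tendsto u atTop (𝓝 E)) :
    (E < ∫ x, (Real.log (J₀ x) - Real.log (J₁ x)) ∂μ₁ →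
      Tendsto (fun n : ℕ => μ₁ {x | HolderGibbs.testStat J₀ J₁ n x - u n > 0}) atTop (𝓝 1)) ∧
    (∫ x, (Real.log (J₀ x) - Real.log (J₁ x)) ∂μ₀ < E →
      Tendsto (fun n : ℕ => μ₀ {x | HolderGibbs.testStat J₀ J₁ n x - u n ≤ 0}) atTop (𝓝 1)) ∧
    (∫ x, (Real.log (J₀ x) - Real.log (J₁ x)) ∂μ₁ < E →
      0 < HolderGibbs.deviation J₀ J₁ J₁ E 0 ∧
      (E ≠ HolderGibbs.cPlus J₀ J₁ →
        Tendsto (fun n : ℕ =>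
            ENNReal.log (μ₁ {x | HolderGibbs.testStat J₀ J₁ n x - u n > 0}) / (n : EReal))
          atTop (𝓝 (-HolderGibbs.deviation J₀ J₁ J₁ E 0)))) ∧
    (E < ∫ x, (Real.log (J₀ x) - Real.log (J₁ x)) ∂μ₀ →
      0 < HolderGibbs.deviation J₀ J₁ J₀ E 0 ∧
      (E ≠ HolderGibbs.cMinus J₀ J₁ →
        Tendsto (fun n : ℕ =>
            ENNReal.log (μ₀ {x | HolderGibbs.testStat J₀ J₁ n x - u n ≤ 0}) / (n : EReal))
          atTop (𝓝 (-HolderGibbs.deviation J₀ J₁ J₀ E 0)))) := by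
  have := h₀.neZero
  have hp₀ := h₀.jacobian.pos
  have hp₁ := h₁.jacobian.pos
  have hφ := h₀.jacobian.holder.sub h₁.jacobian.holder
  have hφ' := h₁.jacobian.holder.sub h₀.jacobian.holder
  have hg₀ := h₀.isGMeasure
  have hg₁ := h₁.isGMeasure
  have := hg₀.prob
  have := hg₁.prob
  have hswap : ∀ μ : Measure (HolderGibbs.Omega d),
      ∫ x, (Real.log (J₁ x) - Real.log (J₀ x)) ∂μ =
        -∫ x, (Real.log (J₀ x) - Real.log (J₁ x)) ∂μ := fun μ => by
    rw [← integral_neg]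
    simp only [neg_sub]
  -- The case n = 0 is excluded, as 1/0 = 0 makes the statistic vanish there.
  have hpos : ∀ᶠ n : ℕ in atTop, ∀ x, HolderGibbs.testStat J₀ J₁ n x - u n > 0 ↔
      n * u n < birkhoffSum HolderGibbs.shift (fun x => Real.log (J₀ x) - Real.log (J₁ x)) n x := by
    filter_upwards [eventually_gt_atTop 0] with n hn x
    exact HolderGibbs.testStat_sub_pos_iff hp₀ hp₁ hn (u n) x
  refine ⟨fun hE => ?_, fun hE => ?_, fun hE => ?_, fun hE => ?_⟩
  -- The complementary event is an upper deviation of -φ above its mean, with thresholds -uₙ.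
  · refine HolderGibbs.tendsto_measure_one_of_compl ?_
      (hg₁.tendsto_measureReal_zero h₁.jacobian.isNormalized h₁.jacobian.holder hφ' hu.neg
        (by rw [hswap]; linarith))
    filter_upwards [hpos] with n hn x hx
    have hx' : ¬ HolderGibbs.testStat J₀ J₁ n x - u n > 0 := hx
    rw [hn, not_lt] at hx'
    rw [Set.mem_ofPred_eq, HolderGibbs.birkhoffSum_swap]
    linarith
  · refine HolderGibbs.tendsto_measure_one_of_compl ?_
      (hg₀.tendsto_measureReal_zero h₀.jacobian.isNormalized h₀.jacobian.holder hφ hu hE)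
    filter_upwards [hpos] with n hn x hx
    have hx' : ¬ HolderGibbs.testStat J₀ J₁ n x - u n ≤ 0 := hx
    rw [not_le] at hx'
    exact ((hn x).1 hx').le
  · rw [HolderGibbs.deviation_eq_rate]
    refine ⟨hg₁.rate_pos h₁.jacobian.isNormalized h₁.jacobian.holder hφ hE, fun hne => ?_⟩
    refine hg₁.tendsto_log_div h₁.jacobian.isNormalized h₁.jacobian.holder hφ hu hE hne ?_ ?_
    · filter_upwards [hpos] with n hn x hx
      exact (hn x).2 hx
    · filter_upwards [hpos] with n hn x hx
      exact ((hn x).1 hx).le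
  -- After the exchange of J₀ and J₁ the event is an upper deviation for -φ, now with a nonstrict
  -- inequality.
  · rw [HolderGibbs.deviation_eq_rate_swap]
    have hE' : ∫ x, (Real.log (J₁ x) - Real.log (J₀ x)) ∂μ₀ < -E := by rw [hswap]; linarith
    refine ⟨hg₀.rate_pos h₀.jacobian.isNormalized h₀.jacobian.holder hφ' hE', fun hne => ?_⟩
    rw [HolderGibbs.cMinus_eq] at hne
    refine hg₀.tendsto_log_div h₀.jacobian.isNormalized h₀.jacobian.holder hφ' hu.neg hE'
      (fun h => hne (by rw [← h, neg_neg])) ?_ ?_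
    · filter_upwards [hpos] with n hn x hx
      rw [Set.mem_ofPred_eq, HolderGibbs.birkhoffSum_swap] at hx
      rw [Set.mem_ofPred_eq, ← not_lt]
      intro h
      have := (hn x).1 h
      linarith
    · filter_upwards [hpos] with n hn x hx
      rw [Set.mem_ofPred_eq, ← not_lt] at hx
      rw [Set.mem_ofPred_eq, HolderGibbs.birkhoffSum_swap]
      by_contra hcon
      exact hx ((hn x).2 (by linarith))
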